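/- Let $K$ be a number field with ring of integers $R$, and write $R^\times=R\setminus\{0\}$. Ideals of $R$ are non-zero. Let $\mathcal T[R]$ be the universal (unital) C*-algebra generated by unitaries $u^x$ ($x\in R$), isometries $s_a$ ($a\in R^\times$) and projections $e_I$ ($I$ an ideal of $R$) subject to $u^xu^y=u^{x+y}$, $s_as_b=s_{ab}$, $s_au^x=u^{ax}s_a$; $e_{I\cap J}=e_Ie_J$, $e_R=1$; $s_ae_Is_a^*=e_{aI}$; $u^xe_I=e_Iu^x$ if $x\in I$ and $e_Iu^xe_I=0$ if $x\notin I$. Let $\bar{\mathcal D}\subset\mathcal T[R]$ be the commutative C*-subalgebra generated by the projections $e_I^x=u^xe_Iu^{-x}$ (which depend only on $x\in R/I$), and let $Y_R$ be its Gelfand spectrum. For a non-zero prime ideal $P$ let $\bar{\mathcal D}_P\subset\bar{\mathcal D}$ be the C*-subalgebra generated by the $e_{P^n}^x$, $n\ge 0$, so that $\bar{\mathcal D}\cong\bigotimes_P\bar{\mathcal D}_P$. With $f_I=\sum_{x\in R/I}e_I^x$ put $\delta_{P^n}^x=e_{P^n}^x\,(f_{P^n}-f_{P^{n+1}})$ for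 $x\in R/P^n$; there is a unique character $\eta_{P^n}^x$ of $\bar{\mathcal D}_P$ with $\eta_{P^n}^x(\delta_{P^n}^x)=1$. For an ideal $I=\prod_P P^{k_P}$ and $x\in R/I$, with images $x_P\in R/P^{k_P}$, let $\eta_I^x=\bigotimes_P\eta_{P^{k_P}}^{x_P}\in Y_R$; that is, $\eta_I^x$ is the unique character of $\bar{\mathcal D}$ with $\eta_I^x(\delta_{P^{k_P}}^{x_P})=1$ for every non-zero prime ideal $P$. Let $\mathbb A_f$ be the ring of finite adeles of $K$ and $\hat R\subset\mathbb A_f$ the subring of integral adeles, with unit group $\hat R^*$. Call pairs $(r,a),(s,b)\in\mathbb A_f\times\mathbb A_f$ equivalent if $b\in a\hat R^*$ and $s-r\in a\hat R$, and write $\omega_{r,a}$ for the class of $(r,a)$. Let $\Omega_{\mathbb A}$ be the set of all classes with the quotient topology, and let $\Omega_R=\{\omega_{r,a}: r,a\in\hat R\}$ with the subspace topology. An ideal $I=\prod_PP^{k_P}$ determines the class $a(I)\in\hat R/\hat R^*$ of all integral adeles whose $P$-adic valuation is $k_P$ for every $P$, and $x\in R/I$ determines a class $r(x,I)\in\hat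 R/a(I)\hat R\cong R/I$, namely that of the diagonal image of any representative of $x$. Corollary 5.3 (adelic description of $Y_R$). The map $\eta_I^x\mapsto\omega_{r(x,I),a(I)}$, defined for $(x,I)\in\bigsqcup_I R/I$, extends to a homeomorphism of $Y_R$ onto $\Omega_R$. -/

import Mathlib

open scoped ENNReal CStarAlgebra
open IsDedekindDomain

universe u

namespace RingToeplitz

/-! ## Generators and relations -/

section Toeplitz

variable (R : Type u) [CommRing R] [IsDomain R]

/-- The non-zero ideals of `R`. -/
abbrev NonzeroIdeal : Type u := {I : Ideal R // I ≠ ⊥}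

variable {R}

namespace NonzeroIdeal

/-- The unit ideal `R`. -/
def top : NonzeroIdeal R := ⟨⊤, top_ne_bot⟩

/-- The intersection `I ∩ J`. -/
def inter (I J : NonzeroIdeal R) : NonzeroIdeal R :=
  ⟨I.1 ⊓ J.1, fun h => (mul_ne_zero I.2 J.2) (le_bot_iff.1 (Ideal.mul_le_inf.trans h.le))⟩

/-- The ideal `aI = {a x | x ∈ I}`, for `a ≠ 0`. -/
def scale (a : nonZeroDivisors R) (I : NonzeroIdeal R) : NonzeroIdeal R :=
  ⟨Ideal.span {(a : R)} * I.1, mul_ne_zero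
    (by simp) I.2⟩

end NonzeroIdeal

variable (R)

/-- A family of elements `u^x` (`x ∈ R`), `s_a` (`a ∈ R \ {0}`), `e_I` (`I` a non-zero ideal) of a
unital `*`-ring `A` that satisfies the defining relations of the Toeplitz algebra of the
`ax+b`-semigroup of `R`. -/
structure ToeplitzFamily (A : Type*) [Ring A] [StarRing A] where
  u : R → A
  s : nonZeroDivisors R → A
  e : NonzeroIdeal R → A
  u_unitary : ∀ x, u x ∈ unitary A
  u_mul : ∀ x y, u x * u y = u (x + y)
  s_isometry : ∀ a, star (s a) * s a = 1
  s_mul : ∀ a b, s a * s b = s (a * b)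
  s_u : ∀ a x, s a * u x = u ((a : R) * x) * s a
  e_proj : ∀ I, IsStarProjection (e I)
  e_inter : ∀ I J, e (I.inter J) = e I * e J
  e_top : e NonzeroIdeal.top = 1
  s_e_s : ∀ a I, s a * e I * star (s a) = e (I.scale a)
  u_e_of_mem : ∀ (I : NonzeroIdeal R) (x : R), x ∈ I.1 → u x * e I = e I * u x
  e_u_e_of_notMem : ∀ (I : NonzeroIdeal R) (x : R), x ∉ I.1 → e I * u x * e I = 0

/-- A realization of the relations in some non-zero unital C*-algebra. -/
structure Realization where
  carrier : Type u
  [cstar : CStarAlgebra carrier]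
  [nontriv : Nontrivial carrier]
  family : ToeplitzFamily R carrier

attribute [instance] Realization.cstar Realization.nontriv

/-- The `ℓ^∞`-product of all C*-algebras in which the relations are realized. -/
def Ambient : Type (u + 1) := lp (fun ρ : Realization R => ρ.carrier) ∞

/-- The `ℓ^∞`-product is a C*-algebra, with componentwise operations and the supremum norm. -/
noncomputable instance : CStarAlgebra (Ambient R) :=
  let _ : CStarAlgebra (lp (fun ρ : Realization R => ρ.carrier) ∞) := { }
  inferInstanceAs (CStarAlgebra (lp (fun ρ : Realization R => ρ.carrier) ∞))

namespace Ambient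

variable {R}

/-- The element of the product with given components of norm at most one. -/
def ofLE (f : ∀ ρ : Realization R, ρ.carrier) (hf : ∀ ρ, ‖f ρ‖ ≤ 1) : Ambient R :=
  ⟨f, memℓp_infty ⟨1, by rintro _ ⟨ρ, rfl⟩; exact hf ρ⟩⟩

/-- The element `(u^x)_ρ` of the product. -/
def u (x : R) : Ambient R :=
  ofLE (fun ρ => ρ.family.u x) fun ρ =>
    (CStarRing.norm_of_mem_unitary (ρ.family.u_unitary x)).le

/-- The element `(s_a)_ρ` of the product. -/
def s (a : nonZeroDivisors R) : Ambient R :=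
  ofLE (fun ρ => ρ.family.s a) fun ρ => by
    have h := CStarRing.norm_star_mul_self (x := ρ.family.s a)
    rw [ρ.family.s_isometry a, norm_one] at h
    nlinarith [norm_nonneg (ρ.family.s a)]

/-- The element `(e_I)_ρ` of the product. -/
def e (I : NonzeroIdeal R) : Ambient R :=
  ofLE (fun ρ => ρ.family.e I) fun ρ => (ρ.family.e_proj I).norm_le

end Ambient

/-- The C*-subalgebra of the product generated by the universal family. -/
noncomputable def toeplitzSubalgebra : StarSubalgebra ℂ (Ambient R) :=
  (StarAlgebra.adjoin ℂ (Set.range Ambient.u ∪ Set.range Ambient.s ∪ Set.range Ambient.e :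
    Set (Ambient R))).topologicalClosure

/-- The universal C*-algebra `𝒯[R]` generated by the `u^x`, `s_a`, `e_I` subject to the relations,
realized as the C*-subalgebra generated by the universal family in the product of all realizations.
(As a number ring `R` is countable, every C*-algebra generated by a realization has at most the
cardinality of the continuum, so the realizations in one universe suffice.) -/
def ToeplitzAlgebra : Type (u + 1) := ↥(toeplitzSubalgebra R)

noncomputable instance : CStarAlgebra (ToeplitzAlgebra R) :=
  have _ : IsClosed (toeplitzSubalgebra R : Set (Ambient R)) :=
    StarSubalgebra.isClosed_topologicalClosure _
  inferInstanceAs (CStarAlgebra ↥(toeplitzSubalgebra R))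

namespace ToeplitzAlgebra

variable {R}

/-- The generator `u^x`. -/
def u (x : R) : ToeplitzAlgebra R :=
  ⟨Ambient.u x, StarSubalgebra.le_topologicalClosure _
    (StarAlgebra.subset_adjoin ℂ _ (.inl (.inl ⟨x, rfl⟩)))⟩

/-- The generator `s_a`. -/
def s (a : nonZeroDivisors R) : ToeplitzAlgebra R :=
  ⟨Ambient.s a, StarSubalgebra.le_topologicalClosure _
    (StarAlgebra.subset_adjoin ℂ _ (.inl (.inr ⟨a, rfl⟩)))⟩

/-- The generator `e_I`. -/
def e (I : NonzeroIdeal R) : ToeplitzAlgebra R :=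
  ⟨Ambient.e I, StarSubalgebra.le_topologicalClosure _
    (StarAlgebra.subset_adjoin ℂ _ (.inr ⟨I, rfl⟩))⟩

/-- Equality in `𝒯[R]` may be tested in all realizations. -/
theorem ext_realization {a b : ToeplitzAlgebra R} (h : ∀ ρ, a.1.1 ρ = b.1.1 ρ) : a = b :=
  Subtype.ext (lp.ext (funext h))

variable (R)

/-- The generators of `𝒯[R]` satisfy the defining relations. -/
noncomputable def family : ToeplitzFamily R (ToeplitzAlgebra R) where
  u := u
  s := s
  e := e
  u_unitary x := by
    rw [Unitary.mem_iff]
    exact ⟨ext_realization fun ρ => (Unitary.mem_iff.1 (ρ.family.u_unitary x)).1,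
      ext_realization fun ρ => (Unitary.mem_iff.1 (ρ.family.u_unitary x)).2⟩
  u_mul x y := ext_realization fun ρ => ρ.family.u_mul x y
  s_isometry a := ext_realization fun ρ => ρ.family.s_isometry a
  s_mul a b := ext_realization fun ρ => ρ.family.s_mul a b
  s_u a x := ext_realization fun ρ => ρ.family.s_u a x
  e_proj I := ⟨ext_realization fun ρ => (ρ.family.e_proj I).1,
    ext_realization fun ρ => (ρ.family.e_proj I).2⟩
  e_inter I J := ext_realization fun ρ => ρ.family.e_inter I J
  e_top := ext_realization fun ρ => ρ.family.e_top
  s_e_s a I := ext_realization fun ρ => ρ.family.s_e_s a I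
  u_e_of_mem I x hx := ext_realization fun ρ => ρ.family.u_e_of_mem I x hx
  e_u_e_of_notMem I x hx := ext_realization fun ρ => ρ.family.e_u_e_of_notMem I x hx

end ToeplitzAlgebra

/-- The universal property of `𝒯[R]`. -/
theorem ToeplitzAlgebra.existsUnique_lift {A : Type u} [CStarAlgebra A] [Nontrivial A]
    (F : ToeplitzFamily R A) :
    ∃! φ : ToeplitzAlgebra R →⋆ₐ[ℂ] A, (∀ x, φ (ToeplitzAlgebra.u x) = F.u x) ∧
      (∀ a, φ (ToeplitzAlgebra.s a) = F.s a) ∧ ∀ I, φ (ToeplitzAlgebra.e I) = F.e I := by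
  let ρ : Realization R := ⟨A, F⟩
  let ev : Ambient R →⋆ₐ[ℂ] A :=
    { toFun := fun a => a.1 ρ
      map_one' := rfl
      map_mul' := fun _ _ => rfl
      map_zero' := rfl
      map_add' := fun _ _ => rfl
      commutes' := fun _ => rfl
      map_star' := fun _ => rfl }
  refine ⟨ev.comp (StarSubalgebra.subtype (toeplitzSubalgebra R)),
    ⟨fun _ => rfl, fun _ => rfl, fun _ => rfl⟩, ?_⟩
  rintro ψ ⟨hu, hs, he⟩
  have hc : ∀ χ : ToeplitzAlgebra R →⋆ₐ[ℂ] A, Continuous χ := fun χ => map_continuous χ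
  refine StarAlgHom.ext_topologicalClosure (hc ψ) (hc _) ?_
  refine StarAlgHom.ext_adjoin
    (s := (Set.range Ambient.u ∪ Set.range Ambient.s ∪ Set.range Ambient.e : Set (Ambient R))) ?_
  rintro ⟨_, hx⟩ ((⟨x, rfl⟩ | ⟨x, rfl⟩) | ⟨x, rfl⟩)
  · exact hu x
  · exact hs x
  · exact he x

/-! ## The canonical commutative subalgebra and its spectrum -/

/-- The C*-subalgebra `D̄` of `𝒯[R]` generated by all `u^x e_I u^{-x}`. -/
noncomputable def Dbar : StarSubalgebra ℂ (ToeplitzAlgebra R) :=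
  (StarAlgebra.adjoin ℂ {d : ToeplitzAlgebra R | ∃ (x : R) (I : NonzeroIdeal R),
    d = ToeplitzAlgebra.u x * ToeplitzAlgebra.e I * ToeplitzAlgebra.u (-x)}).topologicalClosure

/-- The Gelfand spectrum `Y_R` of `D̄`: its characters, with the weak-* topology. -/
abbrev Y : Type (u + 1) := WeakDual.characterSpace ℂ ↥(Dbar R)

variable {R}

/-- `u^x e_I u^{-x}` depends only on the class of `x` modulo `I`. -/
theorem conj_eq_of_sub_mem (I : NonzeroIdeal R) (x y : R) (h : x - y ∈ I.1) :
    ToeplitzAlgebra.u x * ToeplitzAlgebra.e I * ToeplitzAlgebra.u (-x) =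
      ToeplitzAlgebra.u y * ToeplitzAlgebra.e I * ToeplitzAlgebra.u (-y) := by
  have hm : ∀ a b : R, ToeplitzAlgebra.u (a + b) = ToeplitzAlgebra.u a * ToeplitzAlgebra.u b :=
    fun a b => ((ToeplitzAlgebra.family R).u_mul a b).symm
  have hc : ToeplitzAlgebra.u (x - y) * ToeplitzAlgebra.e I =
      ToeplitzAlgebra.e I * ToeplitzAlgebra.u (x - y) :=
    (ToeplitzAlgebra.family R).u_e_of_mem I _ h
  have h1 : ToeplitzAlgebra.u x = ToeplitzAlgebra.u y * ToeplitzAlgebra.u (x - y) := by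
    rw [← hm]; congr 1; ring
  have h2 : ToeplitzAlgebra.u (-y) = ToeplitzAlgebra.u (x - y) * ToeplitzAlgebra.u (-x) := by
    rw [← hm]; congr 1; ring
  rw [h1, h2, mul_assoc (ToeplitzAlgebra.u y), hc]
  simp only [mul_assoc]

/-- The projection `e_I^x = u^x e_I u^{-x}` in `D̄`, for `x ∈ R/I`. -/
noncomputable def eProj (I : NonzeroIdeal R) (x : R ⧸ I.1) : ↥(Dbar R) :=
  Quotient.liftOn' x
    (fun x : R => (⟨ToeplitzAlgebra.u x * ToeplitzAlgebra.e I * ToeplitzAlgebra.u (-x),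
      StarSubalgebra.le_topologicalClosure _
        (StarAlgebra.subset_adjoin ℂ _ ⟨x, I, rfl⟩)⟩ : ↥(Dbar R)))
    fun x y h => Subtype.ext (conj_eq_of_sub_mem I x y ((Submodule.quotientRel_def I.1).1 h))

/-- The projection `f_I = ∑_{x ∈ R/I} u^x e_I u^{-x}` (a finite sum, as `R/I` is finite for the
rings considered). -/
noncomputable def fProj (I : NonzeroIdeal R) : ↥(Dbar R) := ∑ᶠ x : R ⧸ I.1, eProj I x

end Toeplitz

section Dedekind

variable {R : Type u} [CommRing R] [IsDedekindDomain R]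

/-- The ideal `P^n`. -/
def primePow (P : HeightOneSpectrum R) (n : ℕ) : NonzeroIdeal R :=
  ⟨P.asIdeal ^ n, pow_ne_zero n P.ne_bot⟩

/-- `ε_{P^{n+1}} = f_{P^n} - f_{P^{n+1}}`. -/
noncomputable def epsSucc (P : HeightOneSpectrum R) (n : ℕ) : ↥(Dbar R) :=
  fProj (primePow P n) - fProj (primePow P (n + 1))

/-- `δ_{P^n}^x = u^x e_{P^n} u^{-x} ε_{P^{n+1}}`, for `x ∈ R/P^n`. -/
noncomputable def delta (P : HeightOneSpectrum R) (n : ℕ) (x : R ⧸ P.asIdeal ^ n) : ↥(Dbar R) :=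
  eProj (primePow P n) x * epsSucc P n

/-- The exponent of `P` in the prime factorization of `I`. -/
noncomputable def expo (P : HeightOneSpectrum R) (I : NonzeroIdeal R) : ℕ :=
  (Associates.mk P.asIdeal).count (Associates.mk I.1).factors

theorem le_pow_expo (P : HeightOneSpectrum R) (I : NonzeroIdeal R) :
    I.1 ≤ P.asIdeal ^ expo P I := by
  classical
  rw [← Ideal.dvd_iff_le, ← Associates.mk_le_mk_iff_dvd, Associates.mk_pow,
    Associates.prime_pow_dvd_iff_le (Associates.mk_ne_zero.mpr I.2) P.associates_irreducible]
  exact le_rfl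

/-- `φ` is the character `η_I^x = ⨂_P η_{P^k}^{x_P}` of `D̄ = ⨂_P D̄_P`, where `P` runs through all
non-zero prime ideals, `k` is the exponent of `P` in `I`, and `x_P` is the image of `x` in `R/P^k`.
The factor `η_{P^k}^{x_P}`, i.e. the restriction of `φ` to the C*-subalgebra `D̄_P` generated by the
`e_{P^n}^y`, is the character which is defined by taking the value `1` at `δ_{P^k}^{x_P}`. -/
def IsEta (I : NonzeroIdeal R) (x : R ⧸ I.1) (φ : Y R) : Prop :=
  ∀ P : HeightOneSpectrum R,
    φ (delta P (expo P I) (Ideal.Quotient.factor (le_pow_expo P I) x)) = 1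

/-! ## The adelic space -/

variable (R) (K : Type u) [Field K] [Algebra R K] [IsFractionRing R K]

/-- The ring `R̂` of integral adeles, inside the ring of finite adeles. -/
def integralAdeles : Subring (FiniteAdeleRing R K) where
  carrier := {a | ∀ P, a P ∈ P.adicCompletionIntegers K}
  mul_mem' ha hb P := mul_mem (ha P) (hb P)
  one_mem' _ := one_mem _
  add_mem' ha hb P := add_mem (ha P) (hb P)
  zero_mem' _ := zero_mem _
  neg_mem' ha P := neg_mem (ha P)

/-- Pairs `(r,a)` and `(s,b)` of finite adeles are equivalent if `b ∈ a R̂^*` and `s - r ∈ a R̂`. -/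
def pairSetoid : Setoid (FiniteAdeleRing R K × FiniteAdeleRing R K) where
  r p q := (∃ w : (integralAdeles R K)ˣ, q.2 = p.2 * ((w : integralAdeles R K) :
      FiniteAdeleRing R K)) ∧
    ∃ c ∈ integralAdeles R K, q.1 - p.1 = p.2 * c
  iseqv :=
    { refl := fun p => ⟨⟨1, by simp⟩, 0, zero_mem _, by simp⟩
      symm := by
        rintro ⟨r, a⟩ ⟨s, b⟩ ⟨⟨w, hw⟩, c, hc, hrs⟩
        have hinv : (((w : integralAdeles R K) : FiniteAdeleRing R K)) *
            ((w⁻¹ : (integralAdeles R K)ˣ) : integralAdeles R K) = 1 := by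
          rw [← Subring.coe_mul, Units.mul_inv, Subring.coe_one]
        dsimp only at hw hrs ⊢
        refine ⟨⟨w⁻¹, by rw [hw, mul_assoc, hinv, mul_one]⟩,
          -(((w⁻¹ : (integralAdeles R K)ˣ) : integralAdeles R K) * c),
          neg_mem (mul_mem (Subtype.coe_prop _) hc), ?_⟩
        rw [hw, mul_neg, ← mul_assoc, mul_assoc a, hinv, mul_one, ← hrs]
        ring
      trans := by
        rintro ⟨r, a⟩ ⟨s, b⟩ ⟨t, d⟩ ⟨⟨w, hw⟩, c, hc, hrs⟩ ⟨⟨z, hz⟩, c', hc', hst⟩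
        dsimp only at hw hrs hz hst ⊢
        refine ⟨⟨w * z, by rw [hz, hw, Units.val_mul, Subring.coe_mul, mul_assoc]⟩,
          c + ((w : integralAdeles R K) : FiniteAdeleRing R K) * c',
          add_mem hc (mul_mem (Subtype.coe_prop _) hc'), ?_⟩
        rw [mul_add, ← hrs, ← mul_assoc, ← hw, ← hst]
        ring }

/-- The space `Ω_𝔸` of classes `ω_{r,a}`, with the quotient topology. -/
abbrev OmegaAdele : Type u := Quotient (pairSetoid R K)

variable {R K}

/-- The class `ω_{r,a}`. -/
def omega (r a : FiniteAdeleRing R K) : OmegaAdele R K := Quotient.mk (pairSetoid R K) (r, a)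

variable (R K)

/-- The subspace `Ω_R = {ω_{r,a} | r, a ∈ R̂}` of integral elements of `Ω_𝔸`. -/
def OmegaInt : Set (OmegaAdele R K) :=
  {ω | ∃ r ∈ integralAdeles R K, ∃ a ∈ integralAdeles R K, ω = omega r a}

variable {R}

/-- The finite adele with given integral components. -/
def ofIntegral (a : ∀ P : HeightOneSpectrum R, P.adicCompletion K)
    (ha : ∀ P, a P ∈ P.adicCompletionIntegers K) : FiniteAdeleRing R K :=
  ⟨a, Filter.Eventually.of_forall ha⟩

/-- A uniformizer of `K` at `P`. -/
noncomputable def unif (P : HeightOneSpectrum R) : K :=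
  Classical.choose (P.valuation_exists_uniformizer K)

theorem valued_unif_pow (P : HeightOneSpectrum R) (n : ℕ) :
    Valued.v (((unif K P : K) : P.adicCompletion K) ^ n) = WithZero.exp (-(n : ℤ)) := by
  rw [map_pow, HeightOneSpectrum.valuedAdicCompletion_eq_valuation', unif,
    Classical.choose_spec (P.valuation_exists_uniformizer K), ← WithZero.exp_nsmul]
  simp

theorem unif_pow_mem (P : HeightOneSpectrum R) (n : ℕ) :
    ((unif K P : K) : P.adicCompletion K) ^ n ∈ P.adicCompletionIntegers K := by
  rw [HeightOneSpectrum.mem_adicCompletionIntegers, valued_unif_pow]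
  rw [← WithZero.exp_zero, WithZero.exp_le_exp]
  simp

/-- An integral adele representing the class `a(I) ∈ R̂/R̂^*` of `I`, that is, the class of the
integral adeles whose `P`-adic valuation is the exponent of `P` in `I`, for every `P`. -/
noncomputable def idealAdele (I : NonzeroIdeal R) : FiniteAdeleRing R K :=
  ofIntegral K (fun P => ((unif K P : K) : P.adicCompletion K) ^ expo P I)
    fun P => unif_pow_mem K P _

theorem idealAdele_mem (I : NonzeroIdeal R) : idealAdele K I ∈ integralAdeles R K :=
  fun P => unif_pow_mem K P _

/-- The diagonal embedding of `R` in the integral adeles. -/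
theorem algebraMap_mem (x : R) : algebraMap R (FiniteAdeleRing R K) x ∈ integralAdeles R K := by
  intro P
  rw [HeightOneSpectrum.mem_adicCompletionIntegers]
  exact (HeightOneSpectrum.valuedAdicCompletion_eq_valuation' P (algebraMap R K x)).trans_le
    (P.valuation_le_one x)

/-- `I ⊆ a(I) R̂`. -/
theorem exists_eq_idealAdele_mul (I : NonzeroIdeal R) (x : R) (hx : x ∈ I.1) :
    ∃ c ∈ integralAdeles R K, algebraMap R (FiniteAdeleRing R K) x = idealAdele K I * c := by
  have hne : ∀ P : HeightOneSpectrum R,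
      ((unif K P : K) : P.adicCompletion K) ^ expo P I ≠ 0 := by
    intro P h
    have := valued_unif_pow K P (expo P I)
    rw [h, map_zero] at this
    exact WithZero.exp_ne_zero this.symm
  have hint : ∀ P : HeightOneSpectrum R,
      ((algebraMap R K x : K) : P.adicCompletion K) /
        ((unif K P : K) : P.adicCompletion K) ^ expo P I ∈ P.adicCompletionIntegers K := by
    intro P
    rw [HeightOneSpectrum.mem_adicCompletionIntegers, map_div₀, valued_unif_pow,
      HeightOneSpectrum.valuedAdicCompletion_eq_valuation', HeightOneSpectrum.valuation_of_algebraMap]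
    refine div_le_one_of_le₀ ?_ zero_le
    exact (P.intValuation_le_pow_iff_mem x _).2 (le_pow_expo P I hx)
  refine ⟨ofIntegral K _ hint, hint, ?_⟩
  refine FiniteAdeleRing.ext K fun P => ?_
  exact (mul_div_cancel₀ _ (hne P)).symm

theorem omega_algebraMap_eq (I : NonzeroIdeal R) (x y : R) (h : x - y ∈ I.1) :
    omega (algebraMap R (FiniteAdeleRing R K) x) (idealAdele K I) =
      omega (algebraMap R (FiniteAdeleRing R K) y) (idealAdele K I) := by
  refine Quotient.sound (s := pairSetoid R K) ⟨⟨1, by simp⟩, ?_⟩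
  obtain ⟨c, hc, hxc⟩ := exists_eq_idealAdele_mul K I (x - y) h
  refine ⟨-c, neg_mem hc, ?_⟩
  rw [mul_neg, ← hxc, map_sub]
  ring

/-- The point `ω_{r(x,I),a(I)}` of `Ω_R`, for `x ∈ R/I`: here `r(x,I)` is the class in
`R̂/a(I)R̂` of the diagonal image of a representative of `x`. -/
noncomputable def omegaIdeal (I : NonzeroIdeal R) (x : R ⧸ I.1) : ↥(OmegaInt R K) :=
  Quotient.liftOn' x
    (fun x : R => (⟨omega (algebraMap R (FiniteAdeleRing R K) x) (idealAdele K I),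
      _, algebraMap_mem K x, _, idealAdele_mem K I, rfl⟩ : ↥(OmegaInt R K)))
    fun x y h => Subtype.ext
      (omega_algebraMap_eq K I x y ((Submodule.quotientRel_def I.1).1 h))

end Dedekind

end RingToeplitz

/-! Both spaces are quotients of the compact space of pairs (r,a) of integral adeles, by the same
equivalence relation.

A character of the algebra D̄ takes only the values 0 and 1 at the generating projections e_I^x, and
is determined by the set of (I,x) where it is 1 (`character_ext_iff`). Each pair (r,a) yields a
character that is 1 at e_I^x exactly when r - x and a both lie in the closure of I in R̂. To
construct it, let the ax+b-semigroup act on the set of pairs. This realizes the relations on ℓ² of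
that set, and the basis vector at a pair is a common eigenvector of D̄, so its vector functional is
multiplicative there (`exists_character`).

The character of (r,a) records, for all P and n, whether a lies in P^n locally and, if so, the class
of r modulo P^n. This is the valuation of a together with r modulo a, that is, the class of (r,a)
(`pairCharacter_eq_iff`). Every character arises in this way: on finitely many projections it agrees
with the character of a pair coming from some ideal J and y in R, and R̂ is compact
(`pairCharacter_surjective`). The map from pairs onto Y_R is then a quotient map by compactness, and
the one onto Ω_R because Ω_R is open in Ω_𝔸 with preimage the integral pairs.

Finally, the conditions at the δ_{P^k} say that a has valuation exactly k at P and that r is x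
modulo P^k, which characterizes the class of the pair of I and x (`isEta_pairCharacter_iff`). -/

namespace RingToeplitz

/-! ## Operators on `ℓ²(T)` -/

section HilbertSpace

variable {T : Type u}

/-- The Hilbert space `ℓ²(T)`. -/
abbrev EllTwo (T : Type u) : Type u := lp (fun _ : T => ℂ) 2

open scoped Classical in
/-- The standard basis vector of `ℓ²(T)` at `t`. -/
noncomputable def basisVec (t : T) : EllTwo T := lp.single 2 t (1 : ℂ)

theorem orthonormal_basisVec : Orthonormal ℂ (basisVec : T → EllTwo T) := by
  classical
  rw [orthonormal_iff_ite]
  intro s t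
  simp only [basisVec, lp.inner_single_left, lp.single_apply]
  split_ifs with h
  · subst h; simp
  · simp [h]

theorem inner_basisVec_self (t : T) : inner ℂ (basisVec t) (basisVec t) = (1 : ℂ) := by
  simp [inner_self_eq_norm_sq_to_K, orthonormal_basisVec.1 t]

theorem inner_basisVec_of_ne {s t : T} (h : s ≠ t) :
    inner ℂ (basisVec s) (basisVec t) = (0 : ℂ) := orthonormal_basisVec.2 h

theorem basisVec_ne_zero (t : T) : basisVec t ≠ 0 := orthonormal_basisVec.ne_zero t

/-- A vector orthogonal to all basis vectors vanishes. -/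
theorem ext_inner_basisVec {v w : EllTwo T}
    (h : ∀ t, inner ℂ (basisVec t) v = inner ℂ (basisVec t) w) : v = w := by
  classical
  ext t
  simpa [basisVec, lp.inner_single_left] using h t

/-- Bounded operators that agree on the basis vectors are equal. -/
theorem ext_basisVec {A B : EllTwo T →L[ℂ] EllTwo T}
    (h : ∀ t, A (basisVec t) = B (basisVec t)) : A = B := by
  -- For adjoints the claim can be tested on coordinates: the coordinate of A* v at t is the inner
  -- product of A(basis vector at t) with v.
  suffices hs : star A = star B by simpa using congrArg star hs
  ext1 v
  refine ext_inner_basisVec fun t => ?_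
  simp only [ContinuousLinearMap.star_eq_adjoint, ContinuousLinearMap.adjoint_inner_right, h]

/-- The isometry of `ℓ²(T)` that maps the basis vector at `t` to the one at `f t`. -/
noncomputable def isometryOf (f : T → T) (hf : Function.Injective f) :
    EllTwo T →L[ℂ] EllTwo T :=
  (orthonormal_basisVec.comp f hf).orthogonalFamily.linearIsometry.toContinuousLinearMap

@[simp]
theorem isometryOf_basisVec (f : T → T) (hf : Function.Injective f) (t : T) :
    isometryOf f hf (basisVec t) = basisVec (f t) := by
  classical
  have h := (orthonormal_basisVec.comp f hf).orthogonalFamily.linearIsometry_apply_single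
    (i := t) (1 : ℂ)
  rw [LinearIsometry.toSpanSingleton_apply, one_smul] at h
  simpa only [basisVec] using! h

theorem star_isometryOf_mul_self (f : T → T) (hf : Function.Injective f) :
    star (isometryOf f hf) * isometryOf f hf = 1 :=
  (orthonormal_basisVec.comp f hf).orthogonalFamily.linearIsometry.adjoint_comp_self

theorem star_isometryOf_basisVec (f : T → T) (hf : Function.Injective f) (t : T) :
    star (isometryOf f hf) (basisVec (f t)) = basisVec t := by
  rw [← isometryOf_basisVec f hf, ← mul_apply_eq_comp, star_isometryOf_mul_self]
  rfl

theorem star_isometryOf_basisVec_of_notMem (f : T → T) (hf : Function.Injective f) {t : T}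
    (ht : t ∉ Set.range f) : star (isometryOf f hf) (basisVec t) = 0 := by
  refine ext_inner_basisVec fun s => ?_
  rw [ContinuousLinearMap.star_eq_adjoint, ContinuousLinearMap.adjoint_inner_right,
    isometryOf_basisVec, inner_zero_right, inner_basisVec_of_ne fun h => ht ⟨s, h⟩]

theorem isometryOf_mem_unitary (f : T → T) (hf : Function.Bijective f) :
    isometryOf f hf.1 ∈ unitary (EllTwo T →L[ℂ] EllTwo T) := by
  refine Unitary.mem_iff.2 ⟨star_isometryOf_mul_self f hf.1, ext_basisVec fun t => ?_⟩
  obtain ⟨s, rfl⟩ := hf.2 t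
  rw [mul_apply_eq_comp, star_isometryOf_basisVec, isometryOf_basisVec]
  rfl

/-- The projection of `ℓ²(T)` onto the closed span of the basis vectors at points of `E`. -/
noncomputable def projOf (E : Set T) : EllTwo T →L[ℂ] EllTwo T :=
  (Submodule.span ℂ (basisVec '' E)).topologicalClosure.starProjection

theorem isStarProjection_projOf (E : Set T) : IsStarProjection (projOf E) :=
  isStarProjection_starProjection

theorem projOf_basisVec_of_mem {E : Set T} {t : T} (ht : t ∈ E) :
    projOf E (basisVec t) = basisVec t :=
  Submodule.starProjection_eq_self_iff.2
    (Submodule.le_topologicalClosure _ (Submodule.subset_span ⟨t, ht, rfl⟩))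

theorem projOf_basisVec_of_notMem {E : Set T} {t : T} (ht : t ∉ E) :
    projOf E (basisVec t) = 0 := by
  refine (Submodule.starProjection_apply_eq_zero_iff _).2 ?_
  rw [Submodule.orthogonal_closure, Submodule.mem_orthogonal]
  intro v hv
  induction hv using Submodule.span_induction with
  | mem v hv =>
    obtain ⟨s, hs, rfl⟩ := hv
    exact inner_basisVec_of_ne fun h => ht (h ▸ hs)
  | zero => exact inner_zero_left _
  | add v w _ _ hv hw => rw [inner_add_left, hv, hw, add_zero]
  | smul c v _ hv => rw [inner_smul_left, hv, mul_zero]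

end HilbertSpace

/-! ## Realizations on `ℓ²(T)` -/

section Family

variable {R : Type u} [CommRing R] [IsDomain R] {A : Type*} [Ring A] [StarRing A]

namespace ToeplitzFamily

variable (F : ToeplitzFamily R A)

/-- An idempotent unitary is 1. -/
theorem u_zero : F.u 0 = 1 := by
  have h := F.u_mul 0 0
  rw [add_zero] at h
  calc F.u 0 = star (F.u 0) * F.u 0 * F.u 0 := by
        rw [(Unitary.mem_iff.1 (F.u_unitary 0)).1, one_mul]
    _ = 1 := by rw [mul_assoc, h, (Unitary.mem_iff.1 (F.u_unitary 0)).1]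

theorem star_u (x : R) : star (F.u x) = F.u (-x) :=
  left_inv_eq_right_inv (Unitary.mem_iff.1 (F.u_unitary x)).1
    (by rw [F.u_mul, add_neg_cancel, F.u_zero])

theorem star_conj (x : R) (I : NonzeroIdeal R) :
    star (F.u x * F.e I * F.u (-x)) = F.u x * F.e I * F.u (-x) := by
  rw [star_mul, star_mul, F.star_u, F.star_u, neg_neg, (F.e_proj I).2.star_eq, mul_assoc]

end ToeplitzFamily

end Family

section Dbar

variable (R : Type u) [CommRing R] [IsDomain R]

theorem isClosed_Dbar : IsClosed (Dbar R : Set (ToeplitzAlgebra R)) :=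
  StarSubalgebra.isClosed_topologicalClosure _

/-- `D̄` is a C*-algebra. -/
noncomputable instance : CStarAlgebra ↥(Dbar R) :=
  StarSubalgebra.cstarAlgebra _ (h_closed := isClosed_Dbar R)

end Dbar

section Action

variable {R : Type u} [CommRing R] [IsDomain R]

/-- A set with translations by `R`, injective dilations by `R \ {0}`, and subsets indexed by the
non-zero ideals that satisfy the relations of `𝒯[R]`. -/
structure ToeplitzAction (R : Type u) [CommRing R] [IsDomain R] (T : Type u) where
  shift : R → T → T
  scale : nonZeroDivisors R → T → T
  E : NonzeroIdeal R → Set T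
  shift_zero : ∀ t, shift 0 t = t
  shift_shift : ∀ x y t, shift x (shift y t) = shift (x + y) t
  scale_injective : ∀ a, Function.Injective (scale a)
  scale_scale : ∀ a b t, scale a (scale b t) = scale (a * b) t
  scale_shift : ∀ a x t, scale a (shift x t) = shift ((a : R) * x) (scale a t)
  E_inter : ∀ I J, E (I.inter J) = E I ∩ E J
  E_top : E NonzeroIdeal.top = Set.univ
  E_scale : ∀ a I, E (I.scale a) = scale a '' E I
  -- Encodes both relations between u^x and e_I: translation by x preserves E_I for x in I and moves
  -- it off itself otherwise.
  shift_mem : ∀ I x t, t ∈ E I → (shift x t ∈ E I ↔ x ∈ I.1)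

namespace ToeplitzAction

variable {T : Type u} (α : ToeplitzAction R T)

theorem shift_neg_shift (x : R) (t : T) : α.shift (-x) (α.shift x t) = t := by
  rw [α.shift_shift, neg_add_cancel, α.shift_zero]

theorem shift_shift_neg (x : R) (t : T) : α.shift x (α.shift (-x) t) = t := by
  rw [α.shift_shift, add_neg_cancel, α.shift_zero]

theorem shift_bijective (x : R) : Function.Bijective (α.shift x) :=
  Function.bijective_iff_has_inverse.2 ⟨α.shift (-x), α.shift_neg_shift x, α.shift_shift_neg x⟩

theorem shift_mem_iff (I : NonzeroIdeal R) {x : R} (hx : x ∈ I.1) (t : T) :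
    α.shift x t ∈ α.E I ↔ t ∈ α.E I := by
  refine ⟨fun h => ?_, fun h => (α.shift_mem I x t h).2 hx⟩
  rw [← α.shift_neg_shift x t]
  exact (α.shift_mem I _ _ h).2 (neg_mem hx)

/-- The realization of the relations on `ℓ²(T)`. -/
noncomputable def family : ToeplitzFamily R (EllTwo T →L[ℂ] EllTwo T) where
  u x := isometryOf (α.shift x) (α.shift_bijective x).1
  s a := isometryOf (α.scale a) (α.scale_injective a)
  e I := projOf (α.E I)
  u_unitary x := isometryOf_mem_unitary _ (α.shift_bijective x)
  u_mul x y := ext_basisVec fun t => by simp [α.shift_shift]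
  s_isometry a := star_isometryOf_mul_self _ _
  s_mul a b := ext_basisVec fun t => by simp [α.scale_scale]
  s_u a x := ext_basisVec fun t => by simp [α.scale_shift]
  e_proj I := isStarProjection_projOf _
  e_inter I J := ext_basisVec fun t => by
    rw [mul_apply_eq_comp, α.E_inter]
    by_cases hJ : t ∈ α.E J
    · rw [projOf_basisVec_of_mem hJ]
      by_cases hI : t ∈ α.E I
      · rw [projOf_basisVec_of_mem hI, projOf_basisVec_of_mem (Set.mem_inter hI hJ)]
      · rw [projOf_basisVec_of_notMem hI, projOf_basisVec_of_notMem fun h => hI h.1]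
    · rw [projOf_basisVec_of_notMem hJ, projOf_basisVec_of_notMem fun h => hJ h.2, map_zero]
  e_top := ext_basisVec fun t => by
    rw [projOf_basisVec_of_mem (by rw [α.E_top]; trivial)]
    rfl
  s_e_s a I := ext_basisVec fun t => by
    rw [mul_apply_eq_comp, mul_apply_eq_comp, α.E_scale]
    by_cases ht : t ∈ Set.range (α.scale a)
    · obtain ⟨t, rfl⟩ := ht
      rw [star_isometryOf_basisVec]
      by_cases hI : t ∈ α.E I
      · rw [projOf_basisVec_of_mem hI, isometryOf_basisVec,
          projOf_basisVec_of_mem (Set.mem_image_of_mem _ hI)]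
      · rw [projOf_basisVec_of_notMem hI, map_zero, projOf_basisVec_of_notMem]
        rwa [(α.scale_injective a).mem_set_image]
    · rw [star_isometryOf_basisVec_of_notMem _ _ ht, map_zero, map_zero,
        projOf_basisVec_of_notMem fun h => ht (Set.image_subset_range _ _ h)]
  u_e_of_mem I x hx := ext_basisVec fun t => by
    rw [mul_apply_eq_comp, mul_apply_eq_comp, isometryOf_basisVec]
    by_cases hI : t ∈ α.E I
    · rw [projOf_basisVec_of_mem hI, isometryOf_basisVec,
        projOf_basisVec_of_mem ((α.shift_mem_iff I hx t).2 hI)]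
    · rw [projOf_basisVec_of_notMem hI, map_zero,
        projOf_basisVec_of_notMem (mt (α.shift_mem_iff I hx t).1 hI)]
  e_u_e_of_notMem I x hx := ext_basisVec fun t => by
    rw [mul_apply_eq_comp, mul_apply_eq_comp]
    by_cases hI : t ∈ α.E I
    · rw [projOf_basisVec_of_mem hI, isometryOf_basisVec,
        projOf_basisVec_of_notMem (mt (α.shift_mem I x t hI).1 hx)]
      rfl
    · rw [projOf_basisVec_of_notMem hI, map_zero, map_zero]
      rfl

/-- The universal property is stated for non-zero target algebras. -/
theorem nontrivial_operators (t : T) : Nontrivial (EllTwo T →L[ℂ] EllTwo T) :=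
  ⟨1, 0, fun h => basisVec_ne_zero t (by simpa using congrArg (fun A => A (basisVec t)) h)⟩

/-- For each `t`, there is a character of `D̄` whose value at `e_I^x` tells whether `t` belongs to
the translate of `E_I` by `x`. -/
theorem exists_character (t : T) : ∃ φ : Y R, ∀ (I : NonzeroIdeal R) (x : R),
    (α.shift (-x) t ∈ α.E I → φ (eProj I (Ideal.Quotient.mk I.1 x)) = 1) ∧
    (α.shift (-x) t ∉ α.E I → φ (eProj I (Ideal.Quotient.mk I.1 x)) = 0) := by
  have := nontrivial_operators t
  obtain ⟨π, ⟨hu, -, he⟩, -⟩ := ToeplitzAlgebra.existsUnique_lift (R := R) α.family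
  have hgen (x : R) (I : NonzeroIdeal R) :
      (α.shift (-x) t ∈ α.E I → π (ToeplitzAlgebra.u x * ToeplitzAlgebra.e I *
        ToeplitzAlgebra.u (-x)) (basisVec t) = basisVec t) ∧
      (α.shift (-x) t ∉ α.E I → π (ToeplitzAlgebra.u x * ToeplitzAlgebra.e I *
        ToeplitzAlgebra.u (-x)) (basisVec t) = 0) := by
    simp only [map_mul, hu, he, mul_apply_eq_comp, family, isometryOf_basisVec]
    refine ⟨fun h => ?_, fun h => ?_⟩
    · rw [projOf_basisVec_of_mem h, isometryOf_basisVec, α.shift_shift_neg]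
    · rw [projOf_basisVec_of_notMem h, map_zero]
  let c (A : EllTwo T →L[ℂ] EllTwo T) : ℂ := inner ℂ (basisVec t) (A (basisVec t))
  have hc {A : EllTwo T →L[ℂ] EllTwo T} {z : ℂ} (h : A (basisVec t) = z • basisVec t) :
      c A = z := by
    simp only [c, h, inner_smul_right, inner_basisVec_self, mul_one]
  have hcont : Continuous π := map_continuous π
  -- Writing the eigenvalue as c (π d) makes the eigenvector equation a closed condition on d, so it
  -- suffices to check it on the dense subalgebra.
  have heig : ∀ d ∈ Dbar R, π d (basisVec t) = c (π d) • basisVec t := by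
    have key : (Dbar R : Set (ToeplitzAlgebra R)) ⊆
        {d | π d (basisVec t) = c (π d) • basisVec t} := by
      refine closure_minimal ?_ ?_
      · intro d hd
        -- An eigenvector of d need not be one of d*, so the induction carries both.
        suffices h : (∃ z : ℂ, π d (basisVec t) = z • basisVec t) ∧
            ∃ z : ℂ, π (star d) (basisVec t) = z • basisVec t by
          obtain ⟨z, hz⟩ := h.1
          rw [Set.mem_ofPred_eq, hc hz, hz]
        induction hd using StarAlgebra.adjoin_induction with
        | mem d hd =>
          obtain ⟨x, I, rfl⟩ := hd
          have hstar : star (ToeplitzAlgebra.u x * ToeplitzAlgebra.e I * ToeplitzAlgebra.u (-x)) =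
              ToeplitzAlgebra.u x * ToeplitzAlgebra.e I * ToeplitzAlgebra.u (-x) :=
            (ToeplitzAlgebra.family R).star_conj x I
          rw [hstar, and_self]
          by_cases h : α.shift (-x) t ∈ α.E I
          · exact ⟨1, by rw [(hgen x I).1 h, one_smul]⟩
          · exact ⟨0, by rw [(hgen x I).2 h, zero_smul]⟩
        | algebraMap r =>
          refine ⟨⟨r, ?_⟩, ⟨star r, ?_⟩⟩
          · rw [AlgHomClass.commutes, Algebra.algebraMap_eq_smul_one]; rfl
          · rw [← algebraMap_star_comm, AlgHomClass.commutes, Algebra.algebraMap_eq_smul_one]; rfl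
        | add d d' _ _ hd hd' =>
          obtain ⟨⟨z, hz⟩, ⟨w, hw⟩⟩ := hd
          obtain ⟨⟨z', hz'⟩, ⟨w', hw'⟩⟩ := hd'
          refine ⟨⟨z + z', ?_⟩, ⟨w + w', ?_⟩⟩
          · rw [map_add, add_apply, hz, hz', add_smul]
          · rw [star_add, map_add, add_apply, hw, hw', add_smul]
        | mul d d' _ _ hd hd' =>
          obtain ⟨⟨z, hz⟩, ⟨w, hw⟩⟩ := hd
          obtain ⟨⟨z', hz'⟩, ⟨w', hw'⟩⟩ := hd'
          refine ⟨⟨z' * z, ?_⟩, ⟨w * w', ?_⟩⟩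
          · rw [map_mul, mul_apply_eq_comp, hz', map_smul, hz, smul_smul]
          · rw [star_mul, map_mul, mul_apply_eq_comp, hw, map_smul, hw', smul_smul]
        | star d _ hd => exact ⟨hd.2, by rw [star_star]; exact hd.1⟩
      · have h1 : Continuous fun d => π d (basisVec t) := hcont.clm_apply continuous_const
        have h2 : Continuous fun d => c (π d) := continuous_const.inner h1
        exact isClosed_eq h1 (h2.smul continuous_const)
    exact fun d hd => key hd
  let ψ : ↥(Dbar R) →⋆ₐ[ℂ] EllTwo T →L[ℂ] EllTwo T := π.comp (StarSubalgebra.subtype (Dbar R))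
  have hψ (d : ↥(Dbar R)) : ψ d (basisVec t) = c (ψ d) • basisVec t := heig d d.2
  let χ : ↥(Dbar R) →ₐ[ℂ] ℂ := AlgHom.ofLinearMap
    { toFun := fun d => c (ψ d)
      map_add' := fun d d' => by
        simp only [c, map_add, add_apply, inner_add_right]
      map_smul' := fun z d => by
        simp only [c, map_smul, smul_apply, inner_smul_right, RingHom.id_apply, smul_eq_mul] }
    (hc (by rw [map_one, one_smul]; rfl))
    (fun d d' => hc (by
      rw [map_mul, mul_apply_eq_comp, hψ d', map_smul, hψ d, smul_smul, mul_comm]; rfl))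
  refine ⟨WeakDual.CharacterSpace.equivAlgHom.symm χ, fun I x => ⟨fun h => ?_, fun h => ?_⟩⟩
  · exact hc (((hgen x I).1 h).trans (one_smul _ _).symm)
  · exact hc (((hgen x I).2 h).trans (zero_smul _ _).symm)

end ToeplitzAction

end Action

/-! ## The projections `e_I^x` and the characters of `D̄` -/

section Characters

variable {R : Type u} [CommRing R] [IsDomain R]

namespace ToeplitzFamily

variable {A : Type*} [Ring A] [StarRing A] (F : ToeplitzFamily R A)

theorem u_neg_mul (x y : R) : F.u (-x) * F.u y = F.u (y - x) := by
  rw [F.u_mul, neg_add_eq_sub]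

theorem conj_mul_conj (I J : NonzeroIdeal R) (x y : R) :
    F.u x * F.e I * F.u (-x) * (F.u y * F.e J * F.u (-y)) =
      F.u x * (F.e I * F.u (y - x) * F.e J) * F.u (-y) := by
  rw [← F.u_neg_mul]
  simp only [mul_assoc]

theorem conj_mul_conj_same (I J : NonzeroIdeal R) (x : R) :
    F.u x * F.e I * F.u (-x) * (F.u x * F.e J * F.u (-x)) =
      F.u x * F.e (I.inter J) * F.u (-x) := by
  rw [F.conj_mul_conj, sub_self, F.u_zero, mul_one, F.e_inter]

theorem e_mul_of_le {I J : NonzeroIdeal R} (h : I.1 ≤ J.1) : F.e I * F.e J = F.e I := by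
  rw [← F.e_inter]
  congr 1
  exact Subtype.ext (inf_eq_left.2 h)

theorem e_mul_of_ge {I J : NonzeroIdeal R} (h : J.1 ≤ I.1) : F.e I * F.e J = F.e J := by
  rw [← F.e_inter]
  congr 1
  exact Subtype.ext (inf_eq_right.2 h)

/-- Both e_I and e_J lie below e_{I+J}, which reduces the claim to the defining orthogonality
relation for the single ideal I + J. -/
theorem conj_mul_conj_eq_zero (I J : NonzeroIdeal R) (x y : R) (h : y - x ∉ I.1 ⊔ J.1) :
    F.u x * F.e I * F.u (-x) * (F.u y * F.e J * F.u (-y)) = 0 := by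
  let S : NonzeroIdeal R := ⟨I.1 ⊔ J.1, fun hS => I.2 (le_bot_iff.1 (le_sup_left.trans hS.le))⟩
  have h0 : F.e S * F.u (y - x) * F.e S = 0 := F.e_u_e_of_notMem S _ h
  have h1 : F.e I * F.u (y - x) * F.e J = 0 := by
    rw [← F.e_mul_of_le (show I.1 ≤ S.1 from le_sup_left),
      ← F.e_mul_of_ge (show J.1 ≤ S.1 from le_sup_right)]
    calc F.e I * F.e S * F.u (y - x) * (F.e S * F.e J)
        = F.e I * (F.e S * F.u (y - x) * F.e S) * F.e J := by simp only [mul_assoc]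
      _ = 0 := by rw [h0, mul_zero, zero_mul]
  rw [F.conj_mul_conj, h1, mul_zero, zero_mul]

end ToeplitzFamily

/-- The projection `e_I^x` for `x ∈ R`. -/
noncomputable abbrev eAt (I : NonzeroIdeal R) (x : R) : ↥(Dbar R) :=
  eProj I (Ideal.Quotient.mk I.1 x)

theorem eAt_mul_eAt_same (I J : NonzeroIdeal R) (x : R) :
    eAt I x * eAt J x = eAt (I.inter J) x :=
  Subtype.ext ((ToeplitzAlgebra.family R).conj_mul_conj_same I J x)

theorem eAt_mul_eAt_eq_zero (I J : NonzeroIdeal R) (x y : R) (h : y - x ∉ I.1 ⊔ J.1) :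
    eAt I x * eAt J y = 0 :=
  Subtype.ext ((ToeplitzAlgebra.family R).conj_mul_conj_eq_zero I J x y h)

theorem eAt_eq_of_sub_mem (I : NonzeroIdeal R) {x y : R} (h : x - y ∈ I.1) :
    eAt I x = eAt I y :=
  congrArg (eProj I) (Ideal.Quotient.eq.2 h)

theorem eAt_top (x : R) : eAt NonzeroIdeal.top x = 1 := by
  rw [eAt_eq_of_sub_mem NonzeroIdeal.top (x := x) (y := 0) trivial]
  refine Subtype.ext ?_
  have h := (ToeplitzAlgebra.family R).u_zero
  have h' := (ToeplitzAlgebra.family R).e_top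
  change ToeplitzAlgebra.u 0 * ToeplitzAlgebra.e NonzeroIdeal.top * ToeplitzAlgebra.u (-0) = 1
  rw [neg_zero]
  change ToeplitzAlgebra.u 0 = 1 at h
  change ToeplitzAlgebra.e NonzeroIdeal.top = 1 at h'
  rw [h, h', one_mul, one_mul]

theorem character_eAt (φ : Y R) (I : NonzeroIdeal R) (x : R) :
    φ (eAt I x) = 0 ∨ φ (eAt I x) = 1 := by
  have h : eAt I x * eAt I x = eAt I x := by
    rw [eAt_mul_eAt_same]
    congr 1
    exact Subtype.ext (inf_idem _)
  have h' := congrArg φ h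
  rw [map_mul] at h'
  exact IsIdempotentElem.iff_eq_zero_or_one.1 h'

/-- A character that is one at `e_I^x` and at `e_J^y` is one at `e_{I ∩ J}^z` for some common
representative `z` of `x` and `y`. -/
theorem exists_character_inter (φ : Y R) {I J : NonzeroIdeal R} {x y : R}
    (hI : φ (eAt I x) = 1) (hJ : φ (eAt J y) = 1) :
    ∃ z, z - x ∈ I.1 ∧ z - y ∈ J.1 ∧ φ (eAt (I.inter J) z) = 1 := by
  have hxy : y - x ∈ I.1 ⊔ J.1 := by
    by_contra h
    have h' := congrArg φ (eAt_mul_eAt_eq_zero I J x y h)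
    rw [map_mul, hI, hJ, map_zero, mul_one] at h'
    exact one_ne_zero h'
  -- With y - x = i + j, the element x + i = y - j represents both cosets.
  obtain ⟨i, hi, j, hj, hij⟩ := Submodule.mem_sup.1 hxy
  have hx : x + i - x ∈ I.1 := by rwa [add_sub_cancel_left]
  have hy : x + i - y ∈ J.1 := by
    rw [show x + i - y = -j by linear_combination hij]
    exact neg_mem hj
  refine ⟨x + i, hx, hy, ?_⟩
  rw [← eAt_mul_eAt_same, map_mul, eAt_eq_of_sub_mem I hx, eAt_eq_of_sub_mem J hy, hI, hJ, mul_one]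

/-- Under these inclusions e_J^y is a subprojection of e_I^x. -/
theorem character_eAt_of_le (φ : Y R) {I J : NonzeroIdeal R} {x y : R} (hJ : φ (eAt J y) = 1)
    (hle : J.1 ≤ I.1) (hxy : y - x ∈ I.1) : φ (eAt I x) = 1 := by
  have h : eAt I y * eAt J y = eAt J y := by
    rw [eAt_mul_eAt_same]
    congr 1
    exact Subtype.ext (inf_eq_right.2 hle)
  have h' := congrArg φ h
  rwa [map_mul, hJ, mul_one, eAt_eq_of_sub_mem I hxy] at h'

/-- The cosets at which φ is 1 are directed downwards, by repeated use of `exists_character_inter`.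
The common refinement (J,y) gives the ideal pair that reproduces φ on S. -/
theorem exists_character_refinement (φ : Y R) (S : Finset (NonzeroIdeal R × R)) :
    ∃ (J : NonzeroIdeal R) (y : R), φ (eAt J y) = 1 ∧
      ∀ p ∈ S, φ (eAt p.1 p.2) = 1 → J.1 ≤ p.1.1 ∧ y - p.2 ∈ p.1.1 := by
  classical
  induction S using Finset.induction_on with
  | empty => exact ⟨NonzeroIdeal.top, 0, by rw [eAt_top, map_one], by simp⟩
  | insert p S _ ih =>
    obtain ⟨J, y, hJ, hS⟩ := ih
    by_cases hp : φ (eAt p.1 p.2) = 1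
    · obtain ⟨z, hz, hzy, h⟩ := exists_character_inter φ hp hJ
      refine ⟨p.1.inter J, z, h, fun q hq hq1 => ?_⟩
      rcases Finset.mem_insert.1 hq with rfl | hq
      · exact ⟨inf_le_left, hz⟩
      · obtain ⟨hle, hy⟩ := hS q hq hq1
        refine ⟨inf_le_right.trans hle, ?_⟩
        rw [← sub_add_sub_cancel z y q.2]
        exact add_mem (hle hzy) hy
    · refine ⟨J, y, hJ, fun q hq hq1 => ?_⟩
      rcases Finset.mem_insert.1 hq with rfl | hq
      · exact absurd hq1 hp
      · exact hS q hq hq1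

/-- A character is determined by its values at the projections `e_I^x`. -/
theorem character_ext {φ ψ : Y R} (h : ∀ I x, φ (eAt I x) = ψ (eAt I x)) : φ = ψ := by
  let G : Set (ToeplitzAlgebra R) := {d | ∃ (x : R) (I : NonzeroIdeal R),
    d = ToeplitzAlgebra.u x * ToeplitzAlgebra.e I * ToeplitzAlgebra.u (-x)}
  have key : (StarAlgHomClass.toStarAlgHom φ : ↥(Dbar R) →⋆ₐ[ℂ] ℂ) =
      StarAlgHomClass.toStarAlgHom ψ := by
    refine StarAlgHom.ext_topologicalClosure (S := StarAlgebra.adjoin ℂ G)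
      (map_continuous φ) (map_continuous ψ) ?_
    refine StarAlgHom.ext_adjoin (s := G) ?_
    rintro ⟨_, hd⟩ ⟨x, I, rfl⟩
    exact h I x
  exact DFunLike.ext _ _ fun d => DFunLike.congr_fun key d

theorem character_ext_iff {φ ψ : Y R} :
    φ = ψ ↔ ∀ I x, φ (eAt I x) = 1 ↔ ψ (eAt I x) = 1 := by
  refine ⟨fun h I x => by rw [h], fun h => character_ext fun I x => ?_⟩
  rcases character_eAt ψ I x with h0 | h1
  · rcases character_eAt φ I x with h0' | h1'
    · rw [h0, h0']
    · rw [h1', (h I x).1 h1']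
  · rw [h1, (h I x).2 h1]

/-- A continuous injection of a compact space into a Hausdorff space. Thus the topology of the
spectrum is pointwise convergence on the projections e_I^x alone. -/
theorem isClosedEmbedding_eAt : Topology.IsClosedEmbedding
    fun (φ : Y R) (p : NonzeroIdeal R × R) => φ (eAt p.1 p.2) := by
  refine Continuous.isClosedEmbedding (continuous_pi fun p => ?_) fun φ ψ h =>
    character_ext fun I x => congrFun h (I, x)
  exact (WeakDual.eval_continuous (𝕜 := ℂ) (eAt p.1 p.2)).comp continuous_subtype_val

/-- A map into `Y_R` is continuous if each `e_I^x` is one on a clopen set. -/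
theorem continuous_to_Y {X : Type*} [TopologicalSpace X] {f : X → Y R}
    (h : ∀ I x, IsClopen {p | f p (eAt I x) = 1}) : Continuous f := by
  classical
  rw [isClosedEmbedding_eAt.isEmbedding.continuous_iff, continuous_pi_iff]
  rintro ⟨I, x⟩
  -- As the values are 0 or 1, evaluation at e_I^x is the indicator function of a clopen set.
  have hc : Continuous (Set.indicator {p | f p (eAt I x) = 1} fun _ => (1 : ℂ)) :=
    continuous_const.indicator fun p hp => by rw [(h I x).frontier_eq] at hp; exact hp.elim
  convert hc using 1
  ext p
  by_cases hp : f p (eAt I x) = 1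
  · rw [Set.indicator_of_mem (by exact hp)]; exact hp
  · rw [Set.indicator_of_notMem (by exact hp)]
    exact (character_eAt (f p) I x).resolve_right hp

end Characters

/-! ## Exponents of ideals -/

section Expo

variable {R : Type u} [CommRing R] [IsDedekindDomain R]

theorem le_pow_iff_le_expo (P : HeightOneSpectrum R) (I : NonzeroIdeal R) (n : ℕ) :
    I.1 ≤ P.asIdeal ^ n ↔ n ≤ expo P I := by
  classical
  rw [expo, ← Associates.prime_pow_dvd_iff_le (Associates.mk_ne_zero.mpr I.2)
    P.associates_irreducible, ← Associates.mk_pow, Associates.mk_le_mk_iff_dvd, Ideal.dvd_iff_le]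

theorem mem_iff_forall_mem_pow_expo (I : NonzeroIdeal R) (x : R) :
    x ∈ I.1 ↔ ∀ P : HeightOneSpectrum R, x ∈ P.asIdeal ^ expo P I := by
  conv_lhs => rw [← Ideal.iInf_maxPowDividing_eq I.2]
  exact Submodule.mem_iInf _

theorem le_iff_forall_expo_le (I J : NonzeroIdeal R) :
    J.1 ≤ I.1 ↔ ∀ P, expo P I ≤ expo P J := by
  refine ⟨fun h P => (le_pow_iff_le_expo P J _).1 (h.trans (le_pow_expo P I)), fun h x hx => ?_⟩
  exact (mem_iff_forall_mem_pow_expo I x).2 fun P => (le_pow_iff_le_expo P J _).2 (h P) hx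

theorem expo_mul (P : HeightOneSpectrum R) (I J S : NonzeroIdeal R) (h : S.1 = I.1 * J.1) :
    expo P S = expo P I + expo P J := by
  rw [expo, h, ← Associates.mk_mul_mk, Associates.count_mul (Associates.mk_ne_zero.mpr I.2)
    (Associates.mk_ne_zero.mpr J.2) P.associates_irreducible, expo, expo]

/-- In a Dedekind domain (I + J)(I ∩ J) = IJ. The exponent of the sum is the minimum, which leaves
the maximum for the intersection. -/
theorem expo_inter (P : HeightOneSpectrum R) (I J : NonzeroIdeal R) :
    expo P (I.inter J) = max (expo P I) (expo P J) := by
  let S : NonzeroIdeal R := ⟨I.1 ⊔ J.1, fun hS => I.2 (le_bot_iff.1 (le_sup_left.trans hS.le))⟩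
  let M : NonzeroIdeal R := ⟨I.1 * J.1, mul_ne_zero I.2 J.2⟩
  have h1 : expo P M = expo P I + expo P J := expo_mul P I J M rfl
  have h2 : expo P M = expo P S + expo P (I.inter J) :=
    expo_mul P S (I.inter J) M (Ideal.sup_mul_inf I.1 J.1).symm
  have h3 : expo P S = min (expo P I) (expo P J) := by
    refine eq_of_forall_le_iff fun n => ?_
    rw [← le_pow_iff_le_expo, le_min_iff, ← le_pow_iff_le_expo, ← le_pow_iff_le_expo, sup_le_iff]
  omega

theorem expo_top (P : HeightOneSpectrum R) : expo P (NonzeroIdeal.top : NonzeroIdeal R) = 0 := by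
  by_contra h
  have h1 := (le_pow_iff_le_expo P NonzeroIdeal.top 1).2 (Nat.one_le_iff_ne_zero.2 h)
  rw [pow_one] at h1
  exact P.isPrime.ne_top (top_le_iff.1 h1)

theorem expo_primePow_self (P : HeightOneSpectrum R) (n : ℕ) : expo P (primePow P n) = n := by
  refine eq_of_forall_le_iff fun m => ?_
  rw [← le_pow_iff_le_expo]
  exact (Ideal.pow_right_strictAnti P.asIdeal P.ne_bot P.isPrime.ne_top).le_iff_ge

theorem expo_primePow_of_ne {P Q : HeightOneSpectrum R} (h : Q ≠ P) (n : ℕ) :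
    expo Q (primePow P n) = 0 := by
  by_contra h0
  have h1 := (le_pow_iff_le_expo Q (primePow P n) 1).2 (Nat.one_le_iff_ne_zero.2 h0)
  rw [pow_one] at h1
  have h2 : P.asIdeal ≤ Q.asIdeal := Q.isPrime.le_of_pow_le h1
  exact h (HeightOneSpectrum.ext ((P.isMaximal.eq_of_le Q.isPrime.ne_top h2).symm))

theorem finite_expo_ne_zero (I : NonzeroIdeal R) :
    {P : HeightOneSpectrum R | expo P I ≠ 0}.Finite := by
  have h := Associates.finite_factors I.2
  rw [Filter.eventually_cofinite] at h
  exact h.subset fun P hP => by simpa [expo] using hP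

end Expo

/-! ## Ideals of integral adeles -/

section Adeles

variable {R : Type u} [CommRing R] [IsDedekindDomain R]
variable (K : Type u) [Field K] [Algebra R K] [IsFractionRing R K]

theorem adele_sub_apply (a b : FiniteAdeleRing R K) (P : HeightOneSpectrum R) :
    (a - b) P = a P - b P := rfl

theorem adele_neg_apply (a : FiniteAdeleRing R K) (P : HeightOneSpectrum R) :
    (-a) P = -a P := rfl

theorem adele_mul_apply (a b : FiniteAdeleRing R K) (P : HeightOneSpectrum R) :
    (a * b) P = a P * b P := rfl

theorem adele_one_apply (P : HeightOneSpectrum R) : (1 : FiniteAdeleRing R K) P = 1 := rfl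

theorem adele_algebraMap_apply (x : R) (P : HeightOneSpectrum R) :
    algebraMap R (FiniteAdeleRing R K) x P = ((algebraMap R K x : K) : P.adicCompletion K) := rfl

theorem valued_algebraMap (x : R) (P : HeightOneSpectrum R) :
    Valued.v (algebraMap R (FiniteAdeleRing R K) x P) = P.intValuation x := by
  rw [adele_algebraMap_apply, HeightOneSpectrum.valuedAdicCompletion_eq_valuation',
    HeightOneSpectrum.valuation_of_algebraMap]

variable {K} in
theorem mem_integralAdeles {a : FiniteAdeleRing R K} :
    a ∈ integralAdeles R K ↔ ∀ P, Valued.v (a P) ≤ 1 := Iff.rfl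

/-- The closure of a non-zero ideal of `R` in the ring of integral adeles. -/
def adeleIdeal (I : NonzeroIdeal R) : AddSubgroup (FiniteAdeleRing R K) where
  carrier := {a | ∀ P, Valued.v (a P) ≤ WithZero.exp (-(expo P I : ℤ))}
  add_mem' ha hb P := (Valued.v.map_add _ _).trans (max_le (ha P) (hb P))
  zero_mem' P := by
    rw [show (0 : FiniteAdeleRing R K) P = 0 from rfl, map_zero]
    exact zero_le
  neg_mem' ha P := by
    rw [adele_neg_apply, Valuation.map_neg]
    exact ha P

variable {K} in
theorem mem_adeleIdeal {I : NonzeroIdeal R} {a : FiniteAdeleRing R K} :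
    a ∈ adeleIdeal K I ↔ ∀ P, Valued.v (a P) ≤ WithZero.exp (-(expo P I : ℤ)) := Iff.rfl

/-- The closure of I meets R in I itself; this makes the action on pairs satisfy `shift_mem`. -/
theorem algebraMap_mem_adeleIdeal (I : NonzeroIdeal R) (x : R) :
    algebraMap R (FiniteAdeleRing R K) x ∈ adeleIdeal K I ↔ x ∈ I.1 := by
  simp only [mem_adeleIdeal, valued_algebraMap, mem_iff_forall_mem_pow_expo I x,
    HeightOneSpectrum.intValuation_le_pow_iff_mem]

theorem mem_adeleIdeal_inter (I J : NonzeroIdeal R) (a : FiniteAdeleRing R K) :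
    a ∈ adeleIdeal K (I.inter J) ↔ a ∈ adeleIdeal K I ∧ a ∈ adeleIdeal K J := by
  simp only [mem_adeleIdeal, ← forall_and, expo_inter]
  refine forall_congr' fun P => ?_
  rw [← le_min_iff, min_def]
  simp only [WithZero.exp_le_exp]
  split_ifs with h <;> congr! 3 <;> omega

theorem mem_adeleIdeal_top {a : FiniteAdeleRing R K} :
    a ∈ adeleIdeal K NonzeroIdeal.top ↔ a ∈ integralAdeles R K := by
  simp only [mem_adeleIdeal, expo_top, mem_integralAdeles, Nat.cast_zero, neg_zero,
    WithZero.exp_zero]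

theorem intValuation_nonZeroDivisor (b : nonZeroDivisors R) (P : HeightOneSpectrum R) :
    P.intValuation (b : R) =
      WithZero.exp (-(expo P (⟨Ideal.span {(b : R)}, by simp⟩ : NonzeroIdeal R) : ℤ)) :=
  P.intValuation_if_neg (nonZeroDivisors.coe_ne_zero b)

theorem mul_mem_adeleIdeal_scale (b : nonZeroDivisors R) (I : NonzeroIdeal R)
    (a : FiniteAdeleRing R K) :
    algebraMap R (FiniteAdeleRing R K) b * a ∈ adeleIdeal K (I.scale b) ↔ a ∈ adeleIdeal K I := by
  refine forall_congr' fun P => ?_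
  rw [adele_mul_apply, map_mul, valued_algebraMap, intValuation_nonZeroDivisor,
    expo_mul P ⟨Ideal.span {(b : R)}, by simp⟩ I (I.scale b) rfl, Nat.cast_add, neg_add,
    WithZero.exp_add]
  exact mul_le_mul_iff_right₀ (WithZero.exp_pos)

theorem isUnit_algebraMap (b : nonZeroDivisors R) :
    IsUnit (algebraMap R (FiniteAdeleRing R K) b) := by
  rw [IsScalarTower.algebraMap_apply R K]
  exact (IsLocalization.map_units K b).map _

theorem exists_mem_adeleIdeal_of_mem_scale (b : nonZeroDivisors R) (I : NonzeroIdeal R)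
    {a : FiniteAdeleRing R K} (ha : a ∈ adeleIdeal K (I.scale b)) :
    ∃ c ∈ adeleIdeal K I, algebraMap R (FiniteAdeleRing R K) b * c = a := by
  obtain ⟨c, rfl⟩ := (isUnit_algebraMap K b).dvd (a := a)
  exact ⟨c, (mul_mem_adeleIdeal_scale K b I c).1 ha, rfl⟩

theorem adeleIdeal_le_integralAdeles (I : NonzeroIdeal R) {a : FiniteAdeleRing R K}
    (ha : a ∈ adeleIdeal K I) : a ∈ integralAdeles R K := fun P =>
  (ha P).trans (by rw [← WithZero.exp_zero, WithZero.exp_le_exp]; simp)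

/-- At primes other than P the exponent is 0, so the condition there is mere integrality. -/
theorem mem_adeleIdeal_primePow {P : HeightOneSpectrum R} {n : ℕ} {a : FiniteAdeleRing R K}
    (ha : a ∈ integralAdeles R K) :
    a ∈ adeleIdeal K (primePow P n) ↔ Valued.v (a P) ≤ WithZero.exp (-(n : ℤ)) := by
  refine ⟨fun h => ?_, fun h Q => ?_⟩
  · simpa only [expo_primePow_self] using h P
  · by_cases hQ : Q = P
    · subst hQ; rwa [expo_primePow_self]
    · rw [expo_primePow_of_ne hQ, Nat.cast_zero, neg_zero, WithZero.exp_zero]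
      exact ha Q

theorem valued_idealAdele (I : NonzeroIdeal R) (P : HeightOneSpectrum R) :
    Valued.v (idealAdele K I P) = WithZero.exp (-(expo P I : ℤ)) :=
  valued_unif_pow K P _

theorem idealAdele_mem_adeleIdeal (I J : NonzeroIdeal R) :
    idealAdele K J ∈ adeleIdeal K I ↔ J.1 ≤ I.1 := by
  simp only [mem_adeleIdeal, valued_idealAdele, le_iff_forall_expo_le, WithZero.exp_le_exp,
    neg_le_neg_iff, Nat.cast_le]

theorem isOpen_integralAdeles : IsOpen (integralAdeles R K : Set (FiniteAdeleRing R K)) :=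
  RestrictedProduct.isOpen_forall_mem
    (A := fun P : HeightOneSpectrum R => (P.adicCompletionIntegers K : Set (P.adicCompletion K)))
    fun _ => Valued.isOpen_valuationSubring _

theorem isUnit_idealAdele (I : NonzeroIdeal R) : IsUnit (idealAdele K I) := by
  rw [FiniteAdeleRing.isUnit_iff]
  refine ⟨fun P h => ?_, ?_⟩
  · have h' := valued_idealAdele K I P
    rw [h, map_zero] at h'
    exact WithZero.exp_ne_zero h'.symm
  · refine (finite_expo_ne_zero I).subset fun P hP h => hP ?_
    change Valued.v (idealAdele K I P) = 1
    rw [valued_idealAdele, h, Nat.cast_zero, neg_zero, WithZero.exp_zero]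

/-- Multiplication by the inverse of the unit a(I) of the finite adeles carries the closure of I to
the open subring R̂. -/
theorem isOpen_adeleIdeal (I : NonzeroIdeal R) :
    IsOpen (adeleIdeal K I : Set (FiniteAdeleRing R K)) := by
  obtain ⟨w, hw⟩ := isUnit_idealAdele K I
  have hpre : (adeleIdeal K I : Set (FiniteAdeleRing R K)) =
      (fun a => (↑w⁻¹ : FiniteAdeleRing R K) * a) ⁻¹' (integralAdeles R K) := by
    ext a
    obtain ⟨c, rfl⟩ := w.isUnit.dvd (a := a)
    rw [Set.mem_preimage, Units.inv_mul_cancel_left, hw]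
    refine forall_congr' fun P => ?_
    rw [adele_mul_apply, map_mul, valued_idealAdele]
    exact mul_le_iff_le_one_right WithZero.exp_pos
  rw [hpre]
  exact (isOpen_integralAdeles K).preimage (continuous_const.mul continuous_id)

theorem isClopen_adeleIdeal (I : NonzeroIdeal R) :
    IsClopen (adeleIdeal K I : Set (FiniteAdeleRing R K)) :=
  ⟨AddSubgroup.isClosed_of_isOpen _ (isOpen_adeleIdeal K I), isOpen_adeleIdeal K I⟩

variable {K}

/-- Equivalence of pairs of adeles, in terms of the local valuations. -/
theorem pairSetoid_iff {r a s b : FiniteAdeleRing R K} :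
    pairSetoid R K (r, a) (s, b) ↔
      ∀ P, Valued.v (b P) = Valued.v (a P) ∧ Valued.v (s P - r P) ≤ Valued.v (a P) := by
  constructor
  · rintro ⟨⟨w, hw⟩, c, hc, hrs⟩ P
    dsimp only at hw hrs
    have hw1 : Valued.v (((w : integralAdeles R K) : FiniteAdeleRing R K) P) = 1 := by
      have h1 := mem_integralAdeles.1 (w : integralAdeles R K).2 P
      have h2 := mem_integralAdeles.1 ((w⁻¹ : (integralAdeles R K)ˣ) : integralAdeles R K).2 P
      have h3 : ((w : integralAdeles R K) : FiniteAdeleRing R K) P *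
          (((w⁻¹ : (integralAdeles R K)ˣ) : integralAdeles R K) : FiniteAdeleRing R K) P = 1 := by
        rw [← adele_mul_apply, ← Subring.coe_mul, Units.mul_inv, Subring.coe_one, adele_one_apply]
      have h4 := congrArg Valued.v h3
      rw [map_mul, map_one] at h4
      refine le_antisymm h1 ?_
      rw [← h4]
      exact mul_le_of_le_one_right' h2
    refine ⟨?_, ?_⟩
    · rw [hw, adele_mul_apply, map_mul, hw1, mul_one]
    · rw [← adele_sub_apply, hrs, adele_mul_apply, map_mul]
      exact mul_le_of_le_one_right' (hc P)
  · intro h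
    classical
    have hz (P : HeightOneSpectrum R) : a P = 0 ↔ b P = 0 := by
      rw [← map_eq_zero (Valued.v : Valuation (P.adicCompletion K) _), ← (h P).1, map_eq_zero]
    -- The unit relating a to b is b/a componentwise, with 1 at the places where both vanish.
    have unit_mem (a b : FiniteAdeleRing R K) (h : ∀ P, Valued.v (b P) = Valued.v (a P)) (P) :
        (if a P = 0 then 1 else b P / a P) ∈ P.adicCompletionIntegers K := by
      split_ifs with ha
      · exact one_mem _
      · rw [HeightOneSpectrum.mem_adicCompletionIntegers, map_div₀, h P]
        exact div_self_le_one _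
    let w : integralAdeles R K := ⟨ofIntegral K _ (unit_mem a b fun P => (h P).1),
      unit_mem a b fun P => (h P).1⟩
    let w' : integralAdeles R K :=
      ⟨ofIntegral K _ (unit_mem b a fun P => (h P).1.symm),
        unit_mem b a fun P => (h P).1.symm⟩
    have hww : w * w' = 1 := by
      refine Subtype.ext (FiniteAdeleRing.ext K fun P => ?_)
      change (if a P = 0 then 1 else b P / a P) * (if b P = 0 then 1 else a P / b P) = 1
      by_cases ha : a P = 0
      · rw [if_pos ha, if_pos ((hz P).1 ha), mul_one]
      · have hb := mt (hz P).2 ha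
        rw [if_neg ha, if_neg hb]
        field_simp
    refine ⟨⟨⟨w, w', hww, (mul_comm _ _).trans hww⟩, FiniteAdeleRing.ext K fun P => ?_⟩, ?_⟩
    · change b P = a P * (if a P = 0 then 1 else b P / a P)
      by_cases ha : a P = 0
      · rw [if_pos ha, mul_one, ha, (hz P).1 ha]
      · rw [if_neg ha, mul_div_cancel₀ _ ha]
    -- Where a vanishes, s = r by the valuation bound, so the default quotient 0 is a correct
    -- component.
    · have hc (P : HeightOneSpectrum R) : (s P - r P) / a P ∈ P.adicCompletionIntegers K := by
        rw [HeightOneSpectrum.mem_adicCompletionIntegers, map_div₀]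
        exact div_le_one_of_le₀ (h P).2 zero_le
      refine ⟨ofIntegral K _ hc, hc, FiniteAdeleRing.ext K fun P => ?_⟩
      change s P - r P = a P * ((s P - r P) / a P)
      by_cases ha : a P = 0
      · have h2 := (h P).2
        rw [ha, map_zero, le_zero_iff, map_eq_zero] at h2
        rw [h2, zero_div, mul_zero]
      · rw [mul_div_cancel₀ _ ha]

/-- Local integers are approximated by elements of `R`. -/
theorem exists_valued_sub_le (P : HeightOneSpectrum R) {z : P.adicCompletion K}
    (hz : Valued.v z ≤ 1) (n : ℕ) :
    ∃ x : R, Valued.v (z - ((algebraMap R K x : K) : P.adicCompletion K)) ≤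
      WithZero.exp (-(n : ℤ)) := by
  -- Approximate twice: z by k in K, by density of K in its completion, then k, which is itself
  -- integral at P, by an element of R.
  obtain ⟨k, hk⟩ : ∃ k : K, Valued.v (z - (k : P.adicCompletion K)) ≤ WithZero.exp (-(n : ℤ)) := by
    have hne : ((unif K P : K) : P.adicCompletion K) ^ n ≠ 0 := fun h => by
      have := valued_unif_pow K P n
      rw [h, map_zero] at this
      exact WithZero.exp_ne_zero this.symm
    have hopen : IsOpen {y : P.adicCompletion K |
        (z - y) / ((unif K P : K) : P.adicCompletion K) ^ n ∈ P.adicCompletionIntegers K} :=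
      (Valued.isOpen_valuationSubring (P.adicCompletion K)).preimage (by fun_prop)
    obtain ⟨k, hk⟩ := (HeightOneSpectrum.denseRange_algebraMap K P).exists_mem_open hopen
      ⟨z, by simp⟩
    refine ⟨k, ?_⟩
    have hk' : Valued.v ((z - (k : P.adicCompletion K)) /
        ((unif K P : K) : P.adicCompletion K) ^ n) ≤ 1 := hk
    rwa [map_div₀, valued_unif_pow, div_le_one₀ WithZero.exp_pos] at hk'
  have hk1 : P.valuation K k ≤ 1 := by
    rw [← HeightOneSpectrum.valuedAdicCompletion_eq_valuation',
      ← sub_sub_cancel z (k : P.adicCompletion K)]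
    refine (Valued.v.map_sub _ _).trans (max_le hz (hk.trans ?_))
    rw [← WithZero.exp_zero, WithZero.exp_le_exp]
    simp
  obtain ⟨x, hx⟩ := P.exists_valuation_sub_lt_of_integer hk1
    (Units.mk0 (WithZero.exp (-(n : ℤ))) WithZero.exp_ne_zero)
  refine ⟨x, ?_⟩
  rw [← sub_add_sub_cancel z (k : P.adicCompletion K)]
  refine (Valued.v.map_add _ _).trans (max_le hk ?_)
  rw [Valuation.map_sub_swap]
  have h := HeightOneSpectrum.valuedAdicCompletion_eq_valuation' P (algebraMap R K x - k)
  have hsub : ((algebraMap R K x - k : K) : P.adicCompletion K) =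
      ((algebraMap R K x : K) : P.adicCompletion K) - (k : P.adicCompletion K) :=
    map_sub (algebraMap K (P.adicCompletion K)) _ _
  rw [hsub] at h
  rw [h]
  exact hx.le

/-- An element of `ℤᵐ⁰` that lies below all `exp (-n)` above `γ ≤ 1` lies below `γ`. -/
theorem le_of_forall_le_exp {γ δ : WithZero (Multiplicative ℤ)} (hγ : γ ≤ 1)
    (h : ∀ n : ℕ, γ ≤ WithZero.exp (-(n : ℤ)) → δ ≤ WithZero.exp (-(n : ℤ))) : δ ≤ γ := by
  by_cases h0 : γ = 0
  · by_contra hδ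
    have hδ0 : δ ≠ 0 := fun h' => hδ (by rw [h']; exact zero_le)
    -- With n = |log δ| + 1 the bound exp (-n) is strictly below δ.
    have h1 := h (WithZero.log δ).natAbs.succ (by rw [h0]; exact zero_le)
    rw [← WithZero.log_le_iff_le_exp hδ0] at h1
    omega
  · have hl : WithZero.log γ ≤ 0 := by
      rwa [← WithZero.exp_log h0, ← WithZero.exp_zero, WithZero.exp_le_exp] at hγ
    have h1 : -(((-WithZero.log γ).toNat : ℕ) : ℤ) = WithZero.log γ := by omega
    have h2 := h (-WithZero.log γ).toNat
    rw [h1, WithZero.exp_log h0] at h2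
    exact h2 le_rfl

end Adeles

/-! ## Characters attached to pairs of integral adeles -/

section AdelicCharacters

variable {R : Type u} [CommRing R] [IsDedekindDomain R]
variable (K : Type u) [Field K] [Algebra R K] [IsFractionRing R K]

/-- Pairs of integral adeles. -/
abbrev IntegralPair (R : Type u) [CommRing R] [IsDedekindDomain R]
    (K : Type u) [Field K] [Algebra R K] [IsFractionRing R K] : Type u :=
  integralAdeles R K × integralAdeles R K

/-- The diagonal embedding of `R` in the ring of integral adeles. -/
noncomputable def diag : R →+* integralAdeles R K :=
  (algebraMap R (FiniteAdeleRing R K)).codRestrict _ (algebraMap_mem K)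

/-- The `ax+b`-semigroup of `R` acts on the pairs of integral adeles. -/
noncomputable def pairAction : ToeplitzAction R (IntegralPair R K) where
  shift x p := (p.1 + diag K x, p.2)
  scale b p := (diag K (b : R) * p.1, diag K (b : R) * p.2)
  E I := {p | (p.1 : FiniteAdeleRing R K) ∈ adeleIdeal K I ∧
    (p.2 : FiniteAdeleRing R K) ∈ adeleIdeal K I}
  shift_zero p := by simp
  shift_shift x y p := by
    rw [map_add, add_assoc, add_comm (diag K y)]
  scale_injective b p q h := by
    obtain ⟨h1, h2⟩ := Prod.ext_iff.1 h
    exact Prod.ext (Subtype.ext ((isUnit_algebraMap K b).mul_left_cancel (congrArg Subtype.val h1)))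
      (Subtype.ext ((isUnit_algebraMap K b).mul_left_cancel (congrArg Subtype.val h2)))
  scale_scale a b p := by simp [mul_assoc]
  scale_shift a x p := by simp [mul_add]
  E_inter I J := by
    ext p
    simp only [mem_adeleIdeal_inter, Set.mem_ofPred_eq, Set.mem_inter_iff]
    tauto
  E_top := by
    ext p
    simp only [mem_adeleIdeal_top, Set.mem_ofPred_eq, Set.mem_univ, iff_true]
    exact ⟨p.1.2, p.2.2⟩
  E_scale b I := by
    ext p
    constructor
    · rintro ⟨h1, h2⟩
      obtain ⟨c, hc, hc'⟩ := exists_mem_adeleIdeal_of_mem_scale K b I h1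
      obtain ⟨d, hd, hd'⟩ := exists_mem_adeleIdeal_of_mem_scale K b I h2
      exact ⟨(⟨c, adeleIdeal_le_integralAdeles K I hc⟩, ⟨d, adeleIdeal_le_integralAdeles K I hd⟩),
        ⟨hc, hd⟩, Prod.ext (Subtype.ext hc') (Subtype.ext hd')⟩
    · rintro ⟨q, ⟨h1, h2⟩, rfl⟩
      exact ⟨(mul_mem_adeleIdeal_scale K b I _).2 h1, (mul_mem_adeleIdeal_scale K b I _).2 h2⟩
  shift_mem I x p hp := by
    refine ⟨fun h => ?_, fun h => ⟨add_mem hp.1 ((algebraMap_mem_adeleIdeal K I x).2 h), hp.2⟩⟩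
    rw [← algebraMap_mem_adeleIdeal K]
    have h' := sub_mem h.1 hp.1
    rwa [Subring.coe_add, add_sub_cancel_left] at h'

variable {K}

/-- The character of `D̄` attached to a pair of integral adeles. -/
noncomputable def pairCharacter (p : IntegralPair R K) : Y R :=
  ((pairAction K).exists_character p).choose

theorem pairCharacter_eAt (p : IntegralPair R K) (I : NonzeroIdeal R) (x : R) :
    pairCharacter p (eAt I x) = 1 ↔
      (p.1 : FiniteAdeleRing R K) - algebraMap R (FiniteAdeleRing R K) x ∈ adeleIdeal K I ∧
        (p.2 : FiniteAdeleRing R K) ∈ adeleIdeal K I := by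
  have h := ((pairAction K).exists_character p).choose_spec I x
  have hmem : (pairAction K).shift (-x) p ∈ (pairAction K).E I ↔
      (p.1 : FiniteAdeleRing R K) - algebraMap R (FiniteAdeleRing R K) x ∈ adeleIdeal K I ∧
        (p.2 : FiniteAdeleRing R K) ∈ adeleIdeal K I := by
    simp only [pairAction, Set.mem_ofPred_eq, map_neg, ← sub_eq_add_neg]
    exact Iff.rfl
  rw [← hmem]
  refine ⟨fun h1 => ?_, h.1⟩
  by_contra h2
  exact one_ne_zero (h1.symm.trans (h.2 h2))

theorem pairCharacter_primePow (p : IntegralPair R K) (P : HeightOneSpectrum R) (n : ℕ) (x : R) :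
    pairCharacter p (eAt (primePow P n) x) = 1 ↔
      Valued.v ((p.1 : FiniteAdeleRing R K) P - ((algebraMap R K x : K) : P.adicCompletion K)) ≤
          WithZero.exp (-(n : ℤ)) ∧
        Valued.v ((p.2 : FiniteAdeleRing R K) P) ≤ WithZero.exp (-(n : ℤ)) := by
  rw [pairCharacter_eAt, mem_adeleIdeal_primePow K p.2.2,
    mem_adeleIdeal_primePow K (sub_mem p.1.2 (algebraMap_mem K x)), adele_sub_apply,
    adele_algebraMap_apply]

/-- Approximating r at P by elements of R removes the condition on r, so the character determines
the valuation of a at P. -/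
theorem exists_pairCharacter_primePow (p : IntegralPair R K) (P : HeightOneSpectrum R) (n : ℕ) :
    (∃ x, pairCharacter p (eAt (primePow P n) x) = 1) ↔
      Valued.v ((p.2 : FiniteAdeleRing R K) P) ≤ WithZero.exp (-(n : ℤ)) := by
  simp only [pairCharacter_primePow]
  refine ⟨fun ⟨_, h⟩ => h.2, fun h => ?_⟩
  obtain ⟨x, hx⟩ := exists_valued_sub_le P (mem_integralAdeles.1 p.1.2 P) n
  exact ⟨x, hx, h⟩

theorem continuous_pairCharacter : Continuous (pairCharacter : IntegralPair R K → Y R) := by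
  refine continuous_to_Y fun I x => ?_
  simp only [pairCharacter_eAt]
  have h1 : Continuous fun p : IntegralPair R K =>
      (p.1 : FiniteAdeleRing R K) - algebraMap R (FiniteAdeleRing R K) x :=
    (continuous_subtype_val.comp continuous_fst).sub continuous_const
  have h2 : Continuous fun p : IntegralPair R K => (p.2 : FiniteAdeleRing R K) :=
    continuous_subtype_val.comp continuous_snd
  exact ((isClopen_adeleIdeal K I).preimage h1).inter ((isClopen_adeleIdeal K I).preimage h2)

/-- The equivalence relation on pairs of integral adeles. -/
def PairEquiv (p q : IntegralPair R K) : Prop :=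
  pairSetoid R K ((p.1 : FiniteAdeleRing R K), (p.2 : FiniteAdeleRing R K))
    ((q.1 : FiniteAdeleRing R K), (q.2 : FiniteAdeleRing R K))

/-- Testing on powers of primes recovers the valuations of a, and then r modulo every P^n that
contains a locally. Conversely, changing r by a multiple of a does not affect membership in a closed
ideal that contains a. -/
theorem pairCharacter_eq_iff {p q : IntegralPair R K} :
    pairCharacter p = pairCharacter q ↔ PairEquiv p q := by
  constructor
  · intro h
    refine pairSetoid_iff.2 fun P => ?_
    have hv (n : ℕ) : Valued.v ((p.2 : FiniteAdeleRing R K) P) ≤ WithZero.exp (-(n : ℤ)) ↔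
        Valued.v ((q.2 : FiniteAdeleRing R K) P) ≤ WithZero.exp (-(n : ℤ)) := by
      rw [← exists_pairCharacter_primePow, ← exists_pairCharacter_primePow, h]
    refine ⟨le_antisymm (le_of_forall_le_exp (mem_integralAdeles.1 p.2.2 P) fun n => (hv n).1)
      (le_of_forall_le_exp (mem_integralAdeles.1 q.2.2 P) fun n => (hv n).2),
      le_of_forall_le_exp (mem_integralAdeles.1 p.2.2 P) fun n hn => ?_⟩
    -- Equality of the characters makes one x in R approximate both first components to order n.
    obtain ⟨x, hx⟩ := (exists_pairCharacter_primePow p P n).2 hn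
    have hx' := hx
    rw [h] at hx'
    rw [← sub_sub_sub_cancel_right _ _ ((algebraMap R K x : K) : P.adicCompletion K)]
    exact (Valued.v.map_sub _ _).trans (max_le ((pairCharacter_primePow q P n x).1 hx').1
      ((pairCharacter_primePow p P n x).1 hx).1)
  · have key {p q : IntegralPair R K} (h : PairEquiv p q) (I : NonzeroIdeal R) (x : R)
        (hp : pairCharacter p (eAt I x) = 1) : pairCharacter q (eAt I x) = 1 := by
      have h' := pairSetoid_iff.1 h
      obtain ⟨h1, h2⟩ := (pairCharacter_eAt p I x).1 hp
      refine (pairCharacter_eAt q I x).2 ⟨fun P => ?_, fun P => (h' P).1.trans_le (h2 P)⟩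
      have hsub : ((q.1 : FiniteAdeleRing R K) - algebraMap R (FiniteAdeleRing R K) x) P =
          ((q.1 : FiniteAdeleRing R K) P - (p.1 : FiniteAdeleRing R K) P) +
            ((p.1 : FiniteAdeleRing R K) - algebraMap R (FiniteAdeleRing R K) x) P := by
        rw [adele_sub_apply, adele_sub_apply, sub_add_sub_cancel]
      rw [hsub]
      exact (Valued.v.map_add _ _).trans (max_le ((h' P).2.trans (h2 P)) (h1 P))
    exact fun h => character_ext_iff.2 fun I x => ⟨key h I x, key (Setoid.symm' _ h) I x⟩

/-- The pair of integral adeles that corresponds to the class of `x` modulo `I`. -/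
noncomputable def idealPair (I : NonzeroIdeal R) (x : R) : IntegralPair R K :=
  (⟨_, algebraMap_mem K x⟩, ⟨_, idealAdele_mem K I⟩)

theorem pairCharacter_idealPair (I J : NonzeroIdeal R) (x y : R) :
    pairCharacter (idealPair J y : IntegralPair R K) (eAt I x) = 1 ↔
      y - x ∈ I.1 ∧ J.1 ≤ I.1 := by
  rw [pairCharacter_eAt, idealPair, ← map_sub, algebraMap_mem_adeleIdeal, idealAdele_mem_adeleIdeal]

/-- Agreement with φ at one projection is a closed condition on pairs. Finitely many such conditions
are met by an ideal pair, so compactness provides a pair that meets them all. -/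
theorem pairCharacter_surjective [CompactSpace (integralAdeles R K)] :
    Function.Surjective (pairCharacter : IntegralPair R K → Y R) := by
  classical
  intro φ
  let C (i : NonzeroIdeal R × R) : Set (IntegralPair R K) :=
    {p | pairCharacter p (eAt i.1 i.2) = φ (eAt i.1 i.2)}
  have hC (i) : IsClosed (C i) := by
    have h1 := ((continuous_pi_iff.1 isClosedEmbedding_eAt.continuous) i).comp
      (continuous_pairCharacter (R := R) (K := K))
    exact isClosed_eq h1 continuous_const
  obtain ⟨p, hp⟩ : (⋂ i, C i).Nonempty := by
    rw [← Set.univ_inter (⋂ i, C i)]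
    refine isCompact_univ.inter_iInter_nonempty C hC fun S => ?_
    obtain ⟨J, y, hJ, hS⟩ := exists_character_refinement φ S
    refine ⟨idealPair J y, trivial, Set.mem_iInter₂.2 fun i hi => ?_⟩
    have hiff : pairCharacter (idealPair J y : IntegralPair R K) (eAt i.1 i.2) = 1 ↔
        φ (eAt i.1 i.2) = 1 := by
      rw [pairCharacter_idealPair]
      exact ⟨fun h => character_eAt_of_le φ hJ h.2 h.1, fun h => (hS i hi h).symm⟩
    change pairCharacter (idealPair J y : IntegralPair R K) (eAt i.1 i.2) = φ (eAt i.1 i.2)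
    rcases character_eAt φ i.1 i.2 with h0 | h1
    · rw [h0]
      refine (character_eAt _ i.1 i.2).resolve_right fun h => ?_
      exact zero_ne_one (h0.symm.trans (hiff.1 h))
    · rw [h1, hiff.2 h1]
  exact ⟨p, character_ext fun I x => Set.mem_iInter.1 hp (I, x)⟩

end AdelicCharacters

/-! ## The characters `η_I^x` -/

section Eta

variable {R : Type u} [CommRing R] [IsDedekindDomain R] [Ring.HasFiniteQuotients R]

theorem character_fProj_eq_one (φ : Y R) (I : NonzeroIdeal R) (h : ∃ x, φ (eAt I x) = 1) :
    φ (fProj I) = 1 := by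
  classical
  -- Finiteness turns the `finsum` in `fProj` into a genuine sum, rather than possibly the default
  -- 0.
  have : Finite (R ⧸ I.1) := Ring.HasFiniteQuotients.finiteQuotient I.2
  have := Fintype.ofFinite (R ⧸ I.1)
  obtain ⟨x, hx⟩ := h
  rw [fProj, finsum_eq_sum_of_fintype, map_sum,
    Finset.sum_eq_single_of_mem (Ideal.Quotient.mk I.1 x) (Finset.mem_univ _), hx]
  rintro y - hy
  obtain ⟨y, rfl⟩ := Ideal.Quotient.mk_surjective y
  -- Distinct cosets of I have no common representative, so at most one summand is non-zero.
  refine (character_eAt φ I y).resolve_right fun hy1 => hy ?_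
  obtain ⟨z, hzx, hzy, -⟩ := exists_character_inter φ hx hy1
  exact (Ideal.Quotient.eq.2 hzy).symm.trans (Ideal.Quotient.eq.2 hzx)

theorem character_fProj_eq_zero (φ : Y R) (I : NonzeroIdeal R) (h : ¬∃ x, φ (eAt I x) = 1) :
    φ (fProj I) = 0 := by
  have : Finite (R ⧸ I.1) := Ring.HasFiniteQuotients.finiteQuotient I.2
  have := Fintype.ofFinite (R ⧸ I.1)
  rw [fProj, finsum_eq_sum_of_fintype, map_sum]
  refine Finset.sum_eq_zero fun x _ => ?_
  obtain ⟨x, rfl⟩ := Ideal.Quotient.mk_surjective x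
  exact (character_eAt φ I x).resolve_right fun hx => h ⟨x, hx⟩

/-- If φ is 1 at e_{P^n}^x, it is also 1 at f_{P^n}, and the value at δ becomes 1 - φ(f_{P^{n+1}}).
-/
theorem character_delta_eq_one_iff (φ : Y R) (P : HeightOneSpectrum R) (n : ℕ) (x : R) :
    φ (delta P n (Ideal.Quotient.mk _ x)) = 1 ↔
      φ (eAt (primePow P n) x) = 1 ∧ ¬∃ y, φ (eAt (primePow P (n + 1)) y) = 1 := by
  have hd : φ (delta P n (Ideal.Quotient.mk _ x)) =
      φ (eAt (primePow P n) x) * (φ (fProj (primePow P n)) - φ (fProj (primePow P (n + 1)))) := by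
    rw [delta, epsSucc, map_mul, map_sub]
    rfl
  rw [hd]
  rcases character_eAt φ (primePow P n) x with h0 | h1
  · simp [h0]
  · rw [h1, one_mul, character_fProj_eq_one φ _ ⟨x, h1⟩]
    by_cases h : ∃ y, φ (eAt (primePow P (n + 1)) y) = 1
    · simp [character_fProj_eq_one φ _ h, h]
    · simp [character_fProj_eq_zero φ _ h, h]

/-- The valuation is discrete: lying in P^k but not in P^{k+1} means having valuation exactly k. -/
theorem isEta_pairCharacter_iff {K : Type u} [Field K] [Algebra R K] [IsFractionRing R K]
    (I : NonzeroIdeal R) (x : R) (p : IntegralPair R K) :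
    IsEta I (Ideal.Quotient.mk I.1 x) (pairCharacter p) ↔ PairEquiv (idealPair I x) p := by
  rw [PairEquiv, pairSetoid_iff]
  refine forall_congr' fun P => ?_
  rw [Ideal.Quotient.factor_mk, character_delta_eq_one_iff, exists_pairCharacter_primePow,
    pairCharacter_primePow]
  have hi : Valued.v (((idealPair I x : IntegralPair R K).2 : FiniteAdeleRing R K) P) =
    WithZero.exp (-(expo P I : ℤ)) := valued_idealAdele K I P
  rw [hi, and_assoc, and_comm]
  refine and_congr ?_ Iff.rfl
  generalize Valued.v ((p.2 : FiniteAdeleRing R K) P) = γ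
  rw [le_antisymm_iff]
  refine and_congr Iff.rfl ?_
  -- Zero lies in every power of P and is excluded on both sides; it has to be split off before
  -- taking logarithms.
  by_cases h0 : γ = 0
  · simp [h0]
  · rw [← WithZero.log_le_iff_le_exp h0, ← WithZero.le_log_iff_exp_le h0]
    push_cast
    omega

end Eta

/-! ## Compactness of the integral adeles -/

section Compactness

variable {R : Type u} [CommRing R] [IsDedekindDomain R]
variable (K : Type u) [Field K] [Algebra R K] [IsFractionRing R K]

/-- The map from R kills P and, by approximation to order 1, is onto the residue field, which is
thus a quotient of the finite ring R/P. -/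
theorem finite_residueField [Ring.HasFiniteQuotients R] (P : HeightOneSpectrum R) :
    Finite (IsLocalRing.ResidueField (P.adicCompletionIntegers K)) := by
  have : Finite (R ⧸ P.asIdeal) := Ring.HasFiniteQuotients.finiteQuotient P.ne_bot
  let f : R →+* IsLocalRing.ResidueField (P.adicCompletionIntegers K) :=
    (IsLocalRing.residue _).comp (algebraMap R (P.adicCompletionIntegers K))
  have hres (z : P.adicCompletionIntegers K) :
      IsLocalRing.residue _ z = 0 ↔ Valued.v (z : P.adicCompletion K) < 1 := by
    rw [IsLocalRing.residue_eq_zero_iff]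
    exact Valuation.mem_maximalIdeal_iff (v := (Valued.v : Valuation (P.adicCompletion K) _))
  have hcoe (x : R) : ((algebraMap R (P.adicCompletionIntegers K) x :
      P.adicCompletionIntegers K) : P.adicCompletion K) =
      ((algebraMap R K x : K) : P.adicCompletion K) := rfl
  have hf : ∀ x ∈ P.asIdeal, f x = 0 := by
    intro x hx
    refine (hres _).2 ?_
    rw [hcoe, HeightOneSpectrum.valuedAdicCompletion_eq_valuation',
      HeightOneSpectrum.valuation_of_algebraMap]
    exact (P.intValuation_lt_one_iff_mem x).2 hx
  refine Finite.of_surjective (Ideal.Quotient.lift P.asIdeal f hf)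
    (Ideal.Quotient.lift_surjective_of_surjective _ hf fun z => ?_)
  obtain ⟨z, rfl⟩ := IsLocalRing.residue_surjective z
  obtain ⟨x, hx⟩ := exists_valued_sub_le P z.2 1
  refine ⟨x, (sub_eq_zero.1 ?_).symm⟩
  change IsLocalRing.residue _ z - IsLocalRing.residue _ (algebraMap R _ x) = 0
  rw [← map_sub, hres]
  refine lt_of_le_of_lt hx ?_
  rw [← WithZero.exp_zero, WithZero.exp_lt_exp]
  simp

/-- A complete discrete valuation ring with finite residue field is compact; completeness holds
because the integers are closed in the completion. -/
theorem compactSpace_adicCompletionIntegers [Module.Finite ℤ R] [Module.Free ℤ R]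
    [Ring.HasFiniteQuotients R] (P : HeightOneSpectrum R) :
    CompactSpace (P.adicCompletionIntegers K) := by
  have hcl : IsClosed (P.adicCompletionIntegers K : Set (P.adicCompletion K)) :=
    Valued.isClosed_valuationSubring _
  open Valued.integer in
  exact compactSpace_iff_completeSpace_and_isDiscreteValuationRing_and_finite_residueField.2
    ⟨hcl.completeSpace_coe, inferInstanceAs (IsDiscreteValuationRing (P.adicCompletionIntegers K)),
      finite_residueField K P⟩

/-- By Tychonoff, R̂ is a continuous image of a compact product. -/
theorem compactSpace_integralAdeles
    [∀ P : HeightOneSpectrum R, CompactSpace (P.adicCompletionIntegers K)] :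
    CompactSpace (integralAdeles R K) := by
  let ι : (∀ P : HeightOneSpectrum R, P.adicCompletionIntegers K) → integralAdeles R K :=
    fun z => ⟨ofIntegral K (fun P => z P) fun P => (z P).2, fun P => (z P).2⟩
  have hι : Continuous ι := by
    refine Continuous.subtype_mk ?_ _
    exact (RestrictedProduct.isEmbedding_structureMap
      (A := fun P : HeightOneSpectrum R =>
        (P.adicCompletionIntegers K : Set (P.adicCompletion K)))
      (𝓕 := Filter.cofinite)).continuous
  have hsurj : Function.Surjective ι := fun a => ⟨fun P => ⟨a.1 P, a.2 P⟩, rfl⟩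
  exact hsurj.compactSpace hι

end Compactness

/-! ## The homeomorphism -/

section Homeomorphism

variable {R : Type u} [CommRing R] [IsDedekindDomain R]
variable {K : Type u} [Field K] [Algebra R K] [IsFractionRing R K]

/-- The class in `Ω_R` of a pair of integral adeles. -/
def pairClass (p : IntegralPair R K) : ↥(OmegaInt R K) :=
  ⟨omega p.1 p.2, p.1, p.1.2, p.2, p.2.2, rfl⟩

theorem pairClass_eq_iff {p q : IntegralPair R K} : pairClass p = pairClass q ↔ PairEquiv p q :=
  Subtype.ext_iff.trans Quotient.eq

/-- Integrality depends only on the class, so the preimage of Ω_R consists of the integral pairs and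
nothing else. -/
theorem omega_mem_omegaInt_iff (r a : FiniteAdeleRing R K) :
    omega r a ∈ OmegaInt R K ↔ r ∈ integralAdeles R K ∧ a ∈ integralAdeles R K := by
  refine ⟨?_, fun h => ⟨r, h.1, a, h.2, rfl⟩⟩
  rintro ⟨s, hs, b, hb, h⟩
  obtain ⟨⟨w, hw⟩, c, hc, hrs⟩ : pairSetoid R K (s, b) (r, a) := Quotient.exact h.symm
  dsimp only at hw hrs
  refine ⟨?_, hw ▸ mul_mem hb w.1.2⟩
  rw [← sub_add_cancel r s, hrs]
  exact add_mem (mul_mem hb hc) hs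

/-- A quotient map restricts to a quotient map over an open subset of its target. This matches the
subspace topology on Ω_R with the quotient topology from integral pairs. -/
theorem isQuotientMap_pairClass :
    Topology.IsQuotientMap (pairClass : IntegralPair R K → ↥(OmegaInt R K)) := by
  let q : FiniteAdeleRing R K × FiniteAdeleRing R K → OmegaAdele R K := Quotient.mk _
  have hq : Topology.IsQuotientMap q := isQuotientMap_quotient_mk'
  have hpre : q ⁻¹' OmegaInt R K =
      (integralAdeles R K : Set (FiniteAdeleRing R K)) ×ˢ
        (integralAdeles R K : Set (FiniteAdeleRing R K)) :=
    Set.ext fun p => omega_mem_omegaInt_iff p.1 p.2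
  have hopen : IsOpen (OmegaInt R K) := by
    rw [← hq.isOpen_preimage, hpre]
    exact (isOpen_integralAdeles K).prod (isOpen_integralAdeles K)
  let e : IntegralPair R K ≃ₜ ↥(q ⁻¹' OmegaInt R K) :=
    (Homeomorph.Set.prod _ _).symm.trans (Homeomorph.setCongr hpre.symm)
  exact (hq.restrictPreimage_isOpen hopen).comp e.isQuotientMap

/-- Two quotient maps from one space with the same fibres have homeomorphic targets. The one onto
the spectrum is closed, being continuous from a compact to a Hausdorff space. -/
theorem exists_homeomorph [CompactSpace (integralAdeles R K)] :
    ∃ h : Y R ≃ₜ ↥(OmegaInt R K),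
      ∀ p : IntegralPair R K, h (pairCharacter p) = pairClass p := by
  have h1 : Topology.IsQuotientMap (pairCharacter : IntegralPair R K → Y R) :=
    continuous_pairCharacter.isClosedMap.isQuotientMap continuous_pairCharacter
      pairCharacter_surjective
  have h2 := isQuotientMap_pairClass (R := R) (K := K)
  have h12 (p q : IntegralPair R K) :
      pairCharacter p = pairCharacter q ↔ pairClass p = pairClass q :=
    pairCharacter_eq_iff.trans pairClass_eq_iff.symm
  let f (φ : Y R) : ↥(OmegaInt R K) := pairClass (Function.surjInv h1.surjective φ)
  let g (ω : ↥(OmegaInt R K)) : Y R := pairCharacter (Function.surjInv h2.surjective ω)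
  have hf (p : IntegralPair R K) : f (pairCharacter p) = pairClass p :=
    (h12 _ _).1 (Function.surjInv_eq h1.surjective _)
  have hg (p : IntegralPair R K) : g (pairClass p) = pairCharacter p :=
    (h12 _ _).2 (Function.surjInv_eq h2.surjective _)
  refine ⟨⟨⟨f, g, h1.surjective.forall.2 fun p => ?_, h2.surjective.forall.2 fun p => ?_⟩,
    h1.continuous_iff.2 ?_, h2.continuous_iff.2 ?_⟩, hf⟩
  · rw [hf, hg]
  · rw [hg, hf]
  · exact h2.continuous.congr fun p => (hf p).symm
  · exact h1.continuous.congr fun p => (hg p).symm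

theorem omegaIdeal_mk (I : NonzeroIdeal R) (x : R) :
    omegaIdeal K I (Ideal.Quotient.mk I.1 x) = pairClass (idealPair I x) := rfl

/-- Since every character comes from a pair, uniqueness reduces to the fact that the condition fixes
the class of the pair. -/
theorem existsUnique_isEta [Ring.HasFiniteQuotients R] [CompactSpace (integralAdeles R K)]
    (I : NonzeroIdeal R) (x : R) :
    ∃! φ : Y R, IsEta I (Ideal.Quotient.mk I.1 x) φ := by
  refine ⟨pairCharacter (idealPair I x : IntegralPair R K),
    (isEta_pairCharacter_iff I x _).2 (Setoid.refl' _ _), fun φ hφ => ?_⟩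
  obtain ⟨p, rfl⟩ := pairCharacter_surjective (K := K) φ
  exact (pairCharacter_eq_iff.2 ((isEta_pairCharacter_iff I x p).1 hφ)).symm

end Homeomorphism

end RingToeplitz

theorem corollary5p3 (K : Type u) [Field K] [NumberField K] :
    (∀ (I : RingToeplitz.NonzeroIdeal (NumberField.RingOfIntegers K))
        (x : NumberField.RingOfIntegers K ⧸ I.1),
      ∃! φ : RingToeplitz.Y (NumberField.RingOfIntegers K), RingToeplitz.IsEta I x φ) ∧
    ∃ h : RingToeplitz.Y (NumberField.RingOfIntegers K) ≃ₜ
        ↥(RingToeplitz.OmegaInt (NumberField.RingOfIntegers K) K),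
      ∀ (I : RingToeplitz.NonzeroIdeal (NumberField.RingOfIntegers K))
        (x : NumberField.RingOfIntegers K ⧸ I.1)
        (η : RingToeplitz.Y (NumberField.RingOfIntegers K)),
        RingToeplitz.IsEta I x η → h η = RingToeplitz.omegaIdeal K I x := by
  -- Finite quotients of the number ring give compactness of R̂, on which the surjectivity onto the
  -- spectrum and the homeomorphism rest.
  have (P : HeightOneSpectrum (NumberField.RingOfIntegers K)) :
      CompactSpace (P.adicCompletionIntegers K) :=
    RingToeplitz.compactSpace_adicCompletionIntegers K P
  have := RingToeplitz.compactSpace_integralAdeles (R := NumberField.RingOfIntegers K) K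
  refine ⟨fun I x => ?_, ?_⟩
  · obtain ⟨x, rfl⟩ := Ideal.Quotient.mk_surjective x
    exact RingToeplitz.existsUnique_isEta (K := K) I x
  · obtain ⟨h, hh⟩ := RingToeplitz.exists_homeomorph (R := NumberField.RingOfIntegers K) (K := K)
    refine ⟨h, fun I x η hη => ?_⟩
    obtain ⟨x, rfl⟩ := Ideal.Quotient.mk_surjective x
    obtain ⟨p, rfl⟩ := RingToeplitz.pairCharacter_surjective (K := K) η
    rw [hh, RingToeplitz.omegaIdeal_mk]
    exact (RingToeplitz.pairClass_eq_iff.2 ((RingToeplitz.isEta_pairCharacter_iff I x p).1 hη)).symm
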